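/- Conventions. All algebras are over $\mathbb{Q}$ and graded by the non-negative integers; a CDGA is a commutative differential graded algebra with a differential of degree $+1$. A minimal Sullivan algebra is a CDGA of the form $(\Lambda V,d)$, where $V=\bigoplus_{i\ge 2}V^i$ is a graded vector space of finite dimension in each degree, $\Lambda V$ is the free graded commutative algebra on $V$, there are graded subspaces $V(0)\subseteq V(1)\subseteq\cdots$ with union $V$ such that $dV(0)=0$ and $dV(k+1)\subseteq\Lambda V(k)$ for all $k\ge 0$, and $dV\subseteq\Lambda^{\ge 2}V$. It is $N$-connected if $V^i=0$ for all $i\le N$. Two CDGA morphisms $f,g\colon A\to B$ are homotopic if there is a CDGA morphism $H\colon A\to B\otimes\Lambda(t,dt)$, with $|t|=0$ and $|dt|=1$, which restricts to $f$ at $t=0$ and to $g$ at $t=1$. For a minimal Sullivan algebra $M$, the group $\mathcal{E}(M)$ of self-homotopy equivalences is the group of invertible elements of the monoid $[M,M]$ of homotopy classes of CDGA morphisms $M\to M$ under composition. Homotopy types of minimal Sullivan algebras correspond to homotopy types of simply connected rational spaces of finite type, and "rational space" below means minimal Sullivan algebra. Theorem. Every finite group $G$ is realized, as the group of self-homotopy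 equivalences, by infinitely many rational spaces that are as highly connected as desired: for every finite group $G$ and every integer $N\ge 0$ there is an infinite sequence $M_0,M_1,M_2,\dots$ of $N$-connected minimal Sullivan algebras such that $\mathcal{E}(M_k)\cong G$ for every $k$, and such that $M_k$ and $M_l$ are not homotopy equivalent whenever $k\ne l$. -/

import Mathlib

open scoped TensorProduct DirectSum

noncomputable section

universe u v w

/-! ### Commutative differential graded algebras over the rationals -/

/-- A commutative differential (cochain) graded algebra over `ℚ`, graded by `ℕ`: an associative
unital graded algebra with a differential of degree `+1` that is a graded derivation, and whose
product is graded commutative. -/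
structure CDGA where
  carrier : Type u
  [ring : Ring carrier]
  [algebra : Algebra ℚ carrier]
  /-- the homogeneous elements of degree `n` -/
  gr : ℕ → Submodule ℚ carrier
  [graded : GradedAlgebra gr]
  /-- the differential -/
  d : carrier →ₗ[ℚ] carrier
  d_mem : ∀ {n : ℕ} {a : carrier}, a ∈ gr n → d a ∈ gr (n + 1)
  d_d : ∀ a : carrier, d (d a) = 0
  d_mul : ∀ {n : ℕ} {a : carrier}, a ∈ gr n → ∀ b : carrier,
    d (a * b) = d a * b + (-1 : ℚ) ^ n • (a * d b)
  mul_comm : ∀ {m n : ℕ} {a b : carrier}, a ∈ gr m → b ∈ gr n →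
    a * b = (-1 : ℚ) ^ (m * n) • (b * a)

namespace CDGA

attribute [instance] CDGA.ring CDGA.algebra CDGA.graded

instance : CoeSort CDGA.{u} (Type u) := ⟨CDGA.carrier⟩

/-- Morphisms of commutative differential graded algebras. -/
structure Hom (A : CDGA.{u}) (B : CDGA.{v}) where
  toAlgHom : A →ₐ[ℚ] B
  map_mem : ∀ {n : ℕ} {a : A}, a ∈ A.gr n → toAlgHom a ∈ B.gr n
  map_d : ∀ a : A, toAlgHom (A.d a) = B.d (toAlgHom a)

namespace Hom

theorem ext {A : CDGA.{u}} {B : CDGA.{v}} {f g : Hom A B} (h : f.toAlgHom = g.toAlgHom) :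
    f = g := by
  cases f; cases g; congr

/-- The identity morphism. -/
def id (A : CDGA.{u}) : Hom A A where
  toAlgHom := AlgHom.id ℚ A
  map_mem h := h
  map_d _ := rfl

/-- Composition: `g.comp f` is `g ∘ f`. -/
def comp {A : CDGA.{u}} {B : CDGA.{v}} {C : CDGA.{w}} (g : Hom B C) (f : Hom A B) : Hom A C where
  toAlgHom := g.toAlgHom.comp f.toAlgHom
  map_mem h := g.map_mem (f.map_mem h)
  map_d a := by simp [f.map_d, g.map_d]

end Hom

/-! ### The algebra `Λ(t, dt)` -/

open Polynomial

/-- Elements of `Λ(t, dt)`: the pair `p + q ε` stands for `p(t) + q(t) dt`. -/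
abbrev Ltdt : Type := TrivSqZeroExt ℚ[X] ℚ[X]

/-- The grading of `Λ(t, dt)` with `t` in degree `0` and `dt` in degree `1`. -/
def Ltdt.gr (n : ℕ) : Submodule ℚ Ltdt where
  carrier := {w | (n ≠ 0 → w.fst = 0) ∧ (n ≠ 1 → w.snd = 0)}
  add_mem' := by
    rintro a b ⟨h1, h2⟩ ⟨h3, h4⟩
    exact ⟨fun h => by simp [h1 h, h3 h], fun h => by simp [h2 h, h4 h]⟩
  zero_mem' := ⟨fun _ => rfl, fun _ => rfl⟩
  smul_mem' := by
    rintro c a ⟨h1, h2⟩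
    exact ⟨fun h => by simp [h1 h], fun h => by simp [h2 h]⟩

theorem Ltdt.mem_gr {n : ℕ} {w : Ltdt} :
    w ∈ Ltdt.gr n ↔ (n ≠ 0 → w.fst = 0) ∧ (n ≠ 1 → w.snd = 0) := Iff.rfl

instance Ltdt.gradedMonoid : SetLike.GradedMonoid Ltdt.gr where
  one_mem := ⟨fun h => (h rfl).elim, fun _ => by simp⟩
  mul_mem := by
    rintro i j a b ⟨h1, h2⟩ ⟨h3, h4⟩
    refine ⟨fun h => ?_, fun h => ?_⟩
    · rcases Nat.eq_zero_or_pos i with rfl | hi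
      · simp [h3 (by omega)]
      · simp [h1 (by omega)]
    · by_cases hi : i = 0
      · subst hi
        simp [h4 (by omega), h2 (by omega)]
      · by_cases hj : j = 0
        · subst hj
          simp [h4 (by omega), h2 (by omega)]
        · simp [h1 hi, h3 hj]

/-- The splitting of `p + q dt` into `p` and `q dt`. -/
def Ltdt.decomposeHom : Ltdt →+ ⨁ n, Ltdt.gr n where
  toFun w := DirectSum.of (fun n => Ltdt.gr n) 0
      ⟨TrivSqZeroExt.inl w.fst, fun h => (h rfl).elim, fun _ => by simp⟩ +
    DirectSum.of (fun n => Ltdt.gr n) 1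
      ⟨TrivSqZeroExt.inr w.snd, fun _ => by simp, fun h => (h rfl).elim⟩
  map_zero' := by
    rw [← map_zero (DirectSum.of (fun n => Ltdt.gr n) 0), ← add_zero (DirectSum.of _ 0 0),
      ← map_zero (DirectSum.of (fun n => Ltdt.gr n) 1)]
    congr 2
  map_add' a b := by
    rw [add_add_add_comm, ← map_add, ← map_add]
    congr 2
    · exact Subtype.ext (TrivSqZeroExt.ext (by simp) (by simp))
    · exact Subtype.ext (TrivSqZeroExt.ext (by simp) (by simp))

instance Ltdt.decomposition : DirectSum.Decomposition Ltdt.gr :=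
  DirectSum.Decomposition.ofAddHom _ Ltdt.decomposeHom
    (by
      ext w : 1
      simpa [Ltdt.decomposeHom, -DualNumber.inr_eq_smul_eps] using
        TrivSqZeroExt.inl_fst_add_inr_snd_eq w)
    (by
      ext n w : 2
      obtain ⟨w, h1, h2⟩ := w
      simp only [AddMonoidHom.coe_comp, Function.comp_apply, DirectSum.coeAddMonoidHom_of,
        AddMonoidHom.id_apply, Ltdt.decomposeHom, AddMonoidHom.coe_mk, ZeroHom.coe_mk]
      have key : ∀ (m : ℕ) (y : Ltdt.gr m), (y : Ltdt) = 0 →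
          DirectSum.of (fun n => Ltdt.gr n) m y = 0 := by
        intro m y hy
        rw [show y = 0 from Subtype.ext hy, map_zero]
      by_cases hn0 : n = 0
      · subst hn0
        rw [key 1 _ (by simp [h2 (by omega)]), add_zero]
        congr 1
        apply Subtype.ext
        exact TrivSqZeroExt.ext (by simp) (by simp [h2 (by omega)])
      · by_cases hn1 : n = 1
        · subst hn1
          rw [key 0 _ (by simp [h1 hn0]), zero_add]
          congr 1
          apply Subtype.ext
          exact TrivSqZeroExt.ext (by simp [h1 hn0]) (by simp)
        · rw [key 0 _ (by simp [h1 hn0]), key 1 _ (by simp [h2 hn1]), key n _ ?_, add_zero]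
          exact TrivSqZeroExt.ext (h1 hn0) (h2 hn1))

instance Ltdt.gradedAlgebra : GradedAlgebra Ltdt.gr where
  toGradedMonoid := Ltdt.gradedMonoid
  toDecomposition := Ltdt.decomposition

/-- The differential `p + q dt ↦ p' dt`. -/
def Ltdt.d : Ltdt →ₗ[ℚ] Ltdt where
  toFun w := TrivSqZeroExt.inr (derivative w.fst)
  map_add' a b := TrivSqZeroExt.ext (by simp) (by simp)
  map_smul' c a := TrivSqZeroExt.ext (by simp) (by simp)

/-- The commutative differential graded algebra `Λ(t, dt)`. -/
def pathAlgebra : CDGA.{0} where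
  carrier := Ltdt
  gr := Ltdt.gr
  d := Ltdt.d
  d_mem := by
    rintro n a ⟨h1, h2⟩
    refine ⟨fun _ => by simp [Ltdt.d], fun h => ?_⟩
    simp [Ltdt.d, h1 (by omega)]
  d_d a := by simp [Ltdt.d]
  d_mul := by
    rintro n a ⟨h1, h2⟩ b
    rcases Nat.eq_zero_or_pos n with rfl | hn
    · apply TrivSqZeroExt.ext
      · simp [Ltdt.d]
      · simp [Ltdt.d]; ring
    · apply TrivSqZeroExt.ext <;> simp [Ltdt.d, h1 (by omega)]
  mul_comm := by
    rintro m n a b ⟨h1, h2⟩ ⟨h3, h4⟩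
    by_cases hm : m = 0
    · subst hm; simp [_root_.mul_comm]
    · by_cases hn : n = 0
      · subst hn; simp [_root_.mul_comm]
      · apply TrivSqZeroExt.ext <;> simp [h1 hm, h3 hn]

/-- The augmentation of `Λ(t, dt)` at `t = s`, `dt = 0`. -/
def evalAt (s : ℚ) : pathAlgebra →ₗ[ℚ] ℚ where
  toFun w := Polynomial.eval s (TrivSqZeroExt.fst (R := ℚ[X]) (M := ℚ[X]) w)
  map_add' a b := by
    exact (congrArg (Polynomial.eval s) (TrivSqZeroExt.fst_add a b)).trans Polynomial.eval_add
  map_smul' c a := by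
    refine (congrArg (Polynomial.eval s) (TrivSqZeroExt.fst_smul c a)).trans ?_
    simp

/-! ### The tensor product of two CDGAs -/

/-- The underlying algebra of `A ⊗ B`, with the product
`(a ⊗ b) (a' ⊗ b') = (-1) ^ (|b| |a'|) (a a') ⊗ (b b')`. -/
abbrev Tensor (A : CDGA.{u}) (B : CDGA.{v}) : Type (max u v) := GradedTensorProduct ℚ A.gr B.gr

/-- The elements of total degree `n` of `A ⊗ B`. -/
def tensorGr (A : CDGA.{u}) (B : CDGA.{v}) (n : ℕ) : Submodule ℚ (Tensor A B) :=
  Submodule.span ℚ {x | ∃ i j : ℕ, i + j = n ∧ ∃ a ∈ A.gr i, ∃ b ∈ B.gr j,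
    x = GradedTensorProduct.tmul ℚ a b}

/-- The degree involution `a ↦ (-1) ^ |a| a`. -/
def signMap (A : CDGA.{u}) : A →ₗ[ℚ] A :=
  (DirectSum.toModule ℚ ℕ A fun n => (-1 : ℚ) ^ n • (A.gr n).subtype) ∘ₗ
    (DirectSum.decomposeLinearEquiv A.gr).toLinearMap

theorem signMap_of_mem (A : CDGA.{u}) {n : ℕ} {a : A} (ha : a ∈ A.gr n) :
    signMap A a = (-1 : ℚ) ^ n • a := by
  simp only [signMap, LinearMap.comp_apply, LinearEquiv.coe_coe,
    DirectSum.decomposeLinearEquiv_apply]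
  rw [DirectSum.decompose_of_mem A.gr ha, ← DirectSum.lof_eq_of ℚ, DirectSum.toModule_lof]
  simp

/-- The differential `d (a ⊗ b) = d a ⊗ b + (-1) ^ |a| a ⊗ d b` of `A ⊗ B`. -/
def tensorD (A : CDGA.{u}) (B : CDGA.{v}) : Tensor A B →ₗ[ℚ] Tensor A B :=
  (GradedTensorProduct.of ℚ A.gr B.gr).toLinearMap ∘ₗ
    (TensorProduct.map A.d LinearMap.id + TensorProduct.map (signMap A) B.d) ∘ₗ
    (GradedTensorProduct.of ℚ A.gr B.gr).symm.toLinearMap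

theorem tensorD_tmul (A : CDGA.{u}) (B : CDGA.{v}) {n : ℕ} {a : A} (ha : a ∈ A.gr n) (b : B) :
    tensorD A B (GradedTensorProduct.tmul ℚ a b) =
      GradedTensorProduct.tmul ℚ (A.d a) b +
        (-1 : ℚ) ^ n • GradedTensorProduct.tmul ℚ a (B.d b) := by
  simp only [tensorD, LinearMap.comp_apply, LinearEquiv.coe_coe, GradedTensorProduct.of_symm_of,
    LinearMap.add_apply, TensorProduct.map_tmul, LinearMap.id_apply, signMap_of_mem A ha, map_add,
    ← TensorProduct.smul_tmul', map_smul]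

/-- The evaluation `B ⊗ Λ(t, dt) → B` at `t = s`, `dt = 0`. -/
def tensorEval (B : CDGA.{u}) (s : ℚ) : Tensor B pathAlgebra →ₗ[ℚ] B :=
  (TensorProduct.rid ℚ B).toLinearMap ∘ₗ TensorProduct.map LinearMap.id (evalAt s) ∘ₗ
    (GradedTensorProduct.of ℚ B.gr pathAlgebra.gr).symm.toLinearMap

theorem tensorEval_tmul (B : CDGA.{u}) (s : ℚ) (b : B) (w : pathAlgebra) :
    tensorEval B s (GradedTensorProduct.tmul ℚ b w) = evalAt s w • b := by
  simp [tensorEval]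

/-! ### Homotopy -/

/-- Two morphisms `f, g : A → B` are homotopic if there is a morphism of commutative differential
graded algebras `H : A → B ⊗ Λ(t, dt)` that restricts to `f` at `t = 0` and to `g` at `t = 1`. -/
def Homotopic {A : CDGA.{u}} {B : CDGA.{v}} (f g : Hom A B) : Prop :=
  ∃ H : A →ₐ[ℚ] Tensor B pathAlgebra,
    (∀ (n : ℕ) (a : A), a ∈ A.gr n → H a ∈ tensorGr B pathAlgebra n) ∧
    (∀ a : A, H (A.d a) = tensorD B pathAlgebra (H a)) ∧
    (∀ a : A, tensorEval B 0 (H a) = f.toAlgHom a) ∧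
    (∀ a : A, tensorEval B 1 (H a) = g.toAlgHom a)

theorem Homotopic.precomp {A : CDGA.{u}} {B : CDGA.{v}} {C : CDGA.{w}} {f g : Hom B C}
    (h : Homotopic f g) (k : Hom A B) : Homotopic (f.comp k) (g.comp k) := by
  obtain ⟨H, h1, h2, h3, h4⟩ := h
  refine ⟨H.comp k.toAlgHom, fun n a ha => h1 n _ (k.map_mem ha), fun a => ?_, fun a => h3 _,
    fun a => h4 _⟩
  simp [k.map_d, h2]

/-- The algebra map `k ⊗ id : B ⊗ D → C ⊗ D`. -/
def tensorMap {B : CDGA.{u}} {C : CDGA.{v}} (k : Hom B C) (D : CDGA.{w}) :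
    Tensor B D →ₐ[ℚ] Tensor C D :=
  GradedTensorProduct.lift B.gr D.gr
    ((GradedTensorProduct.includeLeft C.gr D.gr).comp k.toAlgHom)
    (GradedTensorProduct.includeRight C.gr D.gr)
    (by
      intro i j a b
      have ha : k.toAlgHom a ∈ C.gr i := k.map_mem a.2
      have h := GradedTensorProduct.tmul_coe_mul_coe_tmul (R := ℚ) C.gr D.gr 1 b
        ⟨k.toAlgHom a, ha⟩ 1
      have h' := GradedTensorProduct.tmul_one_mul_one_tmul (R := ℚ) C.gr D.gr (k.toAlgHom a)
        (b : D)
      simp only [one_mul, mul_one] at h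
      simp only [AlgHom.comp_apply, GradedTensorProduct.includeLeft_apply,
        GradedTensorProduct.includeRight_apply, h, h', smul_smul, Int.units_mul_self, one_smul])

theorem tensorMap_tmul {B : CDGA.{u}} {C : CDGA.{v}} (k : Hom B C) (D : CDGA.{w}) (b : B) (x : D) :
    tensorMap k D (GradedTensorProduct.tmul ℚ b x) =
      GradedTensorProduct.tmul ℚ (k.toAlgHom b) x := by
  rw [tensorMap, GradedTensorProduct.lift_tmul]
  simpa using GradedTensorProduct.tmul_one_mul_one_tmul (R := ℚ) C.gr D.gr (k.toAlgHom b) x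

theorem tensor_induction {B : CDGA.{u}} {D : CDGA.{v}} {P : Tensor B D → Prop} (h0 : P 0)
    (hadd : ∀ x y, P x → P y → P (x + y))
    (ht : ∀ (n : ℕ) (b : B) (x : D), b ∈ B.gr n → P (GradedTensorProduct.tmul ℚ b x))
    (x : Tensor B D) : P x := by
  refine TensorProduct.induction_on (motive := fun y => P (GradedTensorProduct.of ℚ B.gr D.gr y))
    x ?_ ?_ ?_
  · simpa using h0
  · intro b x
    induction b using DirectSum.Decomposition.inductionOn B.gr with
    | zero => simpa using h0
    | homogeneous b => exact ht _ _ _ b.2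
    | add b b' hb hb' =>
      rw [TensorProduct.add_tmul, map_add]
      exact hadd _ _ hb hb'
  · intro x y hx hy
    rw [map_add]
    exact hadd _ _ hx hy

theorem Homotopic.postcomp {A : CDGA.{u}} {B : CDGA.{v}} {C : CDGA.{w}} {f g : Hom A B}
    (h : Homotopic f g) (k : Hom B C) : Homotopic (k.comp f) (k.comp g) := by
  obtain ⟨H, h1, h2, h3, h4⟩ := h
  have hev : ∀ (s : ℚ) (x : Tensor B pathAlgebra),
      tensorEval C s (tensorMap k pathAlgebra x) = k.toAlgHom (tensorEval B s x) := by
    intro s x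
    induction x using tensor_induction with
    | h0 => simp
    | hadd x y hx hy => simp only [map_add, hx, hy]
    | ht n b x hb => rw [tensorMap_tmul, tensorEval_tmul, tensorEval_tmul, map_smul]
  refine ⟨(tensorMap k pathAlgebra).comp H, ?_, ?_, ?_, ?_⟩
  · intro n a ha
    have hle : tensorGr B pathAlgebra n ≤
        (tensorGr C pathAlgebra n).comap (tensorMap k pathAlgebra).toLinearMap := by
      rw [tensorGr, Submodule.span_le]
      rintro _ ⟨i, j, hij, b, hb, x, hx, rfl⟩
      refine Submodule.subset_span ⟨i, j, hij, k.toAlgHom b, k.map_mem hb, x, hx, ?_⟩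
      exact tensorMap_tmul k pathAlgebra b x
    exact hle (h1 n a ha)
  · intro a
    simp only [AlgHom.comp_apply, h2]
    generalize H a = x
    induction x using tensor_induction with
    | h0 => simp
    | hadd x y hx hy => simp only [map_add, hx, hy]
    | ht n b x hb =>
      rw [tensorMap_tmul, tensorD_tmul B _ hb, tensorD_tmul C _ (k.map_mem hb), map_add, map_smul,
        tensorMap_tmul, tensorMap_tmul, k.map_d]
  · intro a
    simp only [AlgHom.comp_apply, hev, h3, Hom.comp]
  · intro a
    simp only [AlgHom.comp_apply, hev, h4, Hom.comp]

/-- The set `[A, B]` of homotopy classes of morphisms `A → B`. (`Quot` divides by the equivalence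
relation generated by homotopy; when `A` is a Sullivan algebra, homotopy already is an equivalence
relation.) -/
def HoHom (A : CDGA.{u}) (B : CDGA.{v}) : Type (max u v) :=
  Quot (Homotopic : Hom A B → Hom A B → Prop)

/-- The homotopy class of a morphism. -/
def HoHom.mk {A : CDGA.{u}} {B : CDGA.{v}} (f : Hom A B) : HoHom A B := Quot.mk _ f

/-- Composition of homotopy classes, `[g] ∘ [f] = [g ∘ f]`. -/
def HoHom.comp {A : CDGA.{u}} {B : CDGA.{v}} {C : CDGA.{w}} (g : HoHom B C) (f : HoHom A B) :
    HoHom A C :=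
  Quot.map₂ Hom.comp (fun g _ _ h => h.postcomp g) (fun _ _ f h => h.precomp f) g f

/-- The monoid `[A, A]` of homotopy classes of self-maps under composition. -/
instance (A : CDGA.{u}) : Monoid (HoHom A A) where
  mul := HoHom.comp
  one := HoHom.mk (Hom.id A)
  mul_assoc := by
    rintro ⟨f⟩ ⟨g⟩ ⟨h⟩
    rfl
  one_mul := by
    rintro ⟨f⟩
    rfl
  mul_one := by
    rintro ⟨f⟩
    rfl

/-- The group `ℰ(A)` of self-homotopy equivalences of `A`: the homotopy classes of self-maps that
have an inverse up to homotopy. -/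
abbrev SelfEquiv (A : CDGA.{u}) : Type u := (HoHom A A)ˣ

/-- `A` and `B` have the same homotopy type. -/
def HomotopyEquivalent (A : CDGA.{u}) (B : CDGA.{v}) : Prop :=
  ∃ (f : HoHom A B) (g : HoHom B A),
    g.comp f = HoHom.mk (Hom.id A) ∧ f.comp g = HoHom.mk (Hom.id B)

/-! ### Minimal Sullivan algebras -/

/-- The relations `v w = (-1) ^ (|v| |w|) w v` between the generators of a free graded commutative
algebra. For `v = w` of odd degree the relation gives `v ^ 2 = 0`. -/
inductive FreeCGA.Rel {I : Type v} (deg : I → ℕ) : FreeAlgebra ℚ I → FreeAlgebra ℚ I → Prop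
  | swap (i j : I) : FreeCGA.Rel deg (FreeAlgebra.ι ℚ i * FreeAlgebra.ι ℚ j)
      ((-1 : ℚ) ^ (deg i * deg j) • (FreeAlgebra.ι ℚ j * FreeAlgebra.ι ℚ i))

/-- The free graded commutative algebra `ΛV` on a graded vector space `V` with a homogeneous basis
indexed by `I`, the basis element `i` having degree `deg i`. -/
abbrev FreeCGA {I : Type v} (deg : I → ℕ) : Type v := RingQuot (FreeCGA.Rel deg)

/-- The canonical map `ΛV → A` determined by homogeneous elements `x i` of `A`. -/
def FreeCGA.toCDGA {I : Type v} (deg : I → ℕ) (A : CDGA.{u}) (x : I → A)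
    (hx : ∀ i, x i ∈ A.gr (deg i)) : FreeCGA deg →ₐ[ℚ] A :=
  RingQuot.liftAlgHom ℚ ⟨FreeAlgebra.lift ℚ x, by
    rintro _ _ ⟨i, j⟩
    simpa using A.mul_comm (hx i) (hx j)⟩

/-- A presentation of `A` as a minimal Sullivan algebra `(ΛV, d)`, where `V` is a simply connected
graded vector space of finite type with homogeneous basis `(x i)`. -/
structure MinimalSullivanBasis (A : CDGA.{u}) where
  I : Type u
  deg : I → ℕ
  x : I → A
  x_mem : ∀ i, x i ∈ A.gr (deg i)
  /-- `V` is concentrated in degrees at least two -/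
  two_le_deg : ∀ i, 2 ≤ deg i
  /-- `V` has finite dimension in each degree -/
  finite_type : ∀ n, {i | deg i = n}.Finite
  /-- as a graded algebra, `A` is freely generated by `V` -/
  free : Function.Bijective (FreeCGA.toCDGA deg A x x_mem)
  /-- nilpotence: `V` is the union of `V(0) ⊆ V(1) ⊆ ⋯`, where `V(k)` is spanned by the `x i` of
  stage at most `k`, with `d V(0) = 0` and `d V(k + 1) ⊆ ΛV(k)` -/
  stage : I → ℕ
  d_stage_zero : ∀ i, stage i = 0 → A.d (x i) = 0
  d_stage : ∀ i, A.d (x i) ∈ Algebra.adjoin ℚ {a | ∃ j, stage j < stage i ∧ a = x j}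
  /-- minimality: `d V ⊆ Λ^{≥ 2} V`, the span of the words of length at least two -/
  minimal : ∀ i, A.d (x i) ∈ Submodule.span ℚ {a | ∃ l : List I, 2 ≤ l.length ∧ a = (l.map x).prod}

/-- `A` is a minimal Sullivan algebra (simply connected and of finite type). -/
def IsMinimalSullivan (A : CDGA.{u}) : Prop := Nonempty (MinimalSullivanBasis A)

/-- `A` is `N`-connected: it is `ℚ` in degree `0` and zero in degrees `1, …, N`. For a minimal
Sullivan algebra `ΛV` this means that `V` has no generators in degrees up to `N`. -/
def IsConnectedUpTo (A : CDGA.{u}) (N : ℕ) : Prop :=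
  A.gr 0 = Submodule.span ℚ {(1 : A)} ∧ ∀ n, 1 ≤ n → n ≤ N → A.gr n = ⊥

end CDGA

end

/-! The left translations of `G` are exactly the permutations of `G` that preserve `g⁻¹ * h` for all
`g, h`. The rigid algebra encodes this coloured complete digraph. It has one even generator `x g`
per vertex. The differential of `z g` has a term `u v ∑ h, colour (g⁻¹ * h) • x h`, which records
the edges leaving `g`, and a term `b * x g ^ (2k+1)`, which singles out the basis `x g`. The
generators `y`, `s`, `t` serve to eliminate scalars.

Rigidity comes from the degrees. The even generators have coprime half-degrees `3k+1` and `7k+2`,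
and the odd degrees are chosen so that a word with the degree of a generator is a single letter, and
no word has degree one less than a closed generator `x g`, `b`, `u`, `v` (`total_cases`). By the
first property every endomorphism is linear on the generators (`exists_represents`). By the second,
integrating a homotopy over the interval shows that homotopic endomorphisms agree on the closed
generators (`Homotopic.apply_eq`), and compatibility with `d` fixes them on the others
(`eq_of_isClosed`). Hence homotopic endomorphisms are equal, and the self-equivalences are the
strict automorphisms.

For an automorphism, coefficients are compared in `φ d = d φ` (`eq_translation`). A `(2k+1)`-st
power without cross terms makes the matrix on the `x g` monomial; `d t` makes its nonzero entries
equal; the colours make its permutation a left translation; `scalars_eq_one` makes the scalars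
trivial. Coefficients are read through homomorphisms `detect` to an exterior algebra on two odd
variables, so no monomial basis of the free algebra is needed.

The lowest generator `b` has degree `6k+2`, so the connectivity grows with `k` and distinct `k` give
distinct homotopy types. -/

noncomputable section

namespace CDGA

/-! ### The free graded commutative algebra as a graded algebra -/

namespace FreeCGA

variable {I : Type v} (deg : I → ℕ)

/-- The generators of the free graded commutative algebra. -/
def gen (i : I) : FreeCGA deg := RingQuot.mkAlgHom ℚ (Rel deg) (FreeAlgebra.ι ℚ i)

theorem gen_mul_gen (i j : I) :
    gen deg i * gen deg j = (-1 : ℚ) ^ (deg i * deg j) • (gen deg j * gen deg i) := by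
  have h := RingQuot.mkAlgHom_rel ℚ (Rel.swap (deg := deg) i j)
  simpa [gen] using h

variable {deg} in
/-- The universal property of the free graded commutative algebra. -/
def lift {B : Type w} [Semiring B] [Algebra ℚ B] (y : I → B)
    (hy : ∀ i j, y i * y j = (-1 : ℚ) ^ (deg i * deg j) • (y j * y i)) : FreeCGA deg →ₐ[ℚ] B :=
  RingQuot.liftAlgHom ℚ ⟨FreeAlgebra.lift ℚ y, by
    rintro _ _ ⟨i, j⟩
    simpa using hy i j⟩

@[simp]
theorem lift_gen {B : Type w} [Semiring B] [Algebra ℚ B] (y : I → B)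
    (hy : ∀ i j, y i * y j = (-1 : ℚ) ^ (deg i * deg j) • (y j * y i)) (i : I) :
    lift y hy (gen deg i) = y i := by
  simp [lift, gen]

variable {deg} in
theorem hom_ext {B : Type w} [Semiring B] [Algebra ℚ B] {f g : FreeCGA deg →ₐ[ℚ] B}
    (h : ∀ i, f (gen deg i) = g (gen deg i)) : f = g := by
  apply RingQuot.ringQuot_ext'
  apply FreeAlgebra.hom_ext
  funext i
  exact h i

/-- The product of a word in the generators. -/
def word (l : List I) : FreeCGA deg := (l.map (gen deg)).prod

@[simp]
theorem word_nil : word deg [] = 1 := rfl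

@[simp]
theorem word_cons (i : I) (l : List I) : word deg (i :: l) = gen deg i * word deg l := by
  simp [word]

theorem word_append (l l' : List I) : word deg (l ++ l') = word deg l * word deg l' := by
  simp [word]

/-- The degree of a word. -/
def wordDeg (l : List I) : ℕ := (l.map deg).sum

@[simp]
theorem wordDeg_nil : wordDeg deg [] = 0 := rfl

@[simp]
theorem wordDeg_cons (i : I) (l : List I) : wordDeg deg (i :: l) = deg i + wordDeg deg l := by
  simp [wordDeg]

theorem wordDeg_append (l l' : List I) :
    wordDeg deg (l ++ l') = wordDeg deg l + wordDeg deg l' := by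
  simp [wordDeg]

/-- The homogeneous elements of degree `n`: the span of the words of degree `n`. -/
def wordGr (n : ℕ) : Submodule ℚ (FreeCGA deg) :=
  Submodule.span ℚ {a | ∃ l : List I, wordDeg deg l = n ∧ a = word deg l}

theorem word_mem (l : List I) : word deg l ∈ wordGr deg (wordDeg deg l) :=
  Submodule.subset_span ⟨l, rfl, rfl⟩

theorem gen_mem (i : I) : gen deg i ∈ wordGr deg (deg i) :=
  Submodule.subset_span ⟨[i], by simp, by simp⟩

instance gradedMonoid : SetLike.GradedMonoid (wordGr deg) where
  one_mem := word_mem deg []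
  mul_mem := by
    intro i j a b ha hb
    have h : wordGr deg i * wordGr deg j ≤ wordGr deg (i + j) := by
      rw [wordGr, wordGr, Submodule.span_mul_span, Submodule.span_le]
      rintro _ ⟨_, ⟨l, rfl, rfl⟩, _, ⟨l', rfl, rfl⟩, rfl⟩
      exact Submodule.subset_span ⟨l ++ l', wordDeg_append deg l l', (word_append deg l l').symm⟩
    exact h (Submodule.mul_mem_mul ha hb)

/-- The sign exponent is bilinear in the degrees, so the relation passes from letters to words by
two inductions and then to spans by linearity. -/
theorem mem_mul_comm {m n : ℕ} {a b : FreeCGA deg} (ha : a ∈ wordGr deg m) (hb : b ∈ wordGr deg n) :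
    a * b = (-1 : ℚ) ^ (m * n) • (b * a) := by
  have key : ∀ (i : I) (l : List I), gen deg i * word deg l =
      (-1 : ℚ) ^ (deg i * wordDeg deg l) • (word deg l * gen deg i) := by
    intro i l
    induction l with
    | nil => simp
    | cons j l ih =>
      rw [word_cons, wordDeg_cons, ← mul_assoc, gen_mul_gen, smul_mul_assoc, mul_assoc, ih,
        mul_smul_comm, smul_smul, mul_assoc, mul_add, pow_add]
  have key2 : ∀ l l' : List I, word deg l * word deg l' =
      (-1 : ℚ) ^ (wordDeg deg l * wordDeg deg l') • (word deg l' * word deg l) := by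
    intro l l'
    induction l with
    | nil => simp
    | cons j l ih =>
      rw [word_cons, wordDeg_cons, mul_assoc, ih, mul_smul_comm, ← mul_assoc, key,
        smul_mul_assoc, smul_smul, mul_assoc, add_mul, pow_add, _root_.mul_comm]
  induction ha using Submodule.span_induction with
  | zero => simp
  | add x y _ _ hx hy => rw [add_mul, mul_add, smul_add, hx, hy]
  | smul c x _ hx => rw [smul_mul_assoc, hx, mul_smul_comm, smul_comm]
  | mem x hx =>
    obtain ⟨l, rfl, rfl⟩ := hx
    induction hb using Submodule.span_induction with
    | zero => simp
    | add x y _ _ hx hy => rw [add_mul, mul_add, smul_add, hx, hy]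
    | smul c x _ hx => rw [smul_mul_assoc, mul_smul_comm, hx, smul_comm]
    | mem x hx =>
      obtain ⟨l', rfl, rfl⟩ := hx
      exact key2 l l'

/-- The decomposition of the free graded commutative algebra into homogeneous parts. -/
def decomposeHom : FreeCGA deg →ₐ[ℚ] ⨁ n, wordGr deg n :=
  lift (deg := deg)
    (fun i => DirectSum.of (fun n => wordGr deg n) (deg i) ⟨gen deg i, gen_mem deg i⟩) (by
    intro i j
    rw [DirectSum.of_mul_of, DirectSum.of_mul_of, ← DirectSum.lof_eq_of ℚ, ← DirectSum.lof_eq_of ℚ,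
      ← map_smul, DirectSum.lof_eq_of ℚ, DirectSum.lof_eq_of ℚ]
    -- The two products lie in the summands `deg i + deg j` and `deg j + deg i`, so they are
    -- compared in the sigma type.
    apply DirectSum.of_eq_of_gradedMonoid_eq
    refine Sigma.subtype_ext (add_comm _ _) ?_
    exact gen_mul_gen deg i j)

theorem decomposeHom_word (l : List I) : decomposeHom deg (word deg l) =
    DirectSum.of (fun n => wordGr deg n) (wordDeg deg l) ⟨word deg l, word_mem deg l⟩ := by
  induction l with
  | nil => exact map_one _
  | cons i l ih =>
    have h : decomposeHom deg (word deg (i :: l)) =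
        decomposeHom deg (gen deg i) * decomposeHom deg (word deg l) := by
      rw [word_cons, map_mul]
    rw [h, ih, decomposeHom, lift_gen, DirectSum.of_mul_of]
    apply DirectSum.of_eq_of_gradedMonoid_eq
    refine Sigma.subtype_ext (wordDeg_cons deg i l).symm ?_
    exact (word_cons deg i l).symm

instance gradedAlgebra : GradedAlgebra (wordGr deg) :=
  GradedAlgebra.ofAlgHom (wordGr deg) (decomposeHom deg)
    (by
      apply hom_ext
      intro i
      simp [decomposeHom])
    (by
      rintro n ⟨a, ha⟩
      have h : ∀ (m : ℕ) (hm : a ∈ wordGr deg m), decomposeHom deg a =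
          DirectSum.lof ℚ ℕ (fun n => wordGr deg n) m ⟨a, hm⟩ := by
        intro m hm
        clear ha
        induction hm using Submodule.span_induction with
        | zero =>
          rw [map_zero]
          exact (map_zero _).symm
        | add x y hx hy h1 h2 =>
          rw [map_add, h1, h2, ← map_add]
          rfl
        | smul c x hx h1 =>
          rw [map_smul, h1, ← map_smul]
          rfl
        | mem x hx =>
          obtain ⟨l, rfl, rfl⟩ := hx
          exact decomposeHom_word deg l
      exact h n ha)

theorem span_word : Submodule.span ℚ (Set.range (word deg)) = ⊤ := by
  rw [eq_top_iff]
  rintro a -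
  induction a using DirectSum.Decomposition.inductionOn (wordGr deg) with
  | zero => exact zero_mem _
  | homogeneous a =>
    refine Submodule.span_mono ?_ a.2
    rintro _ ⟨l, -, rfl⟩
    exact ⟨l, rfl⟩
  | add a b ha hb => exact add_mem ha hb

variable {deg} in
theorem word_induction {P : FreeCGA deg → Prop} (hw : ∀ l, P (word deg l)) (h0 : P 0)
    (hadd : ∀ a b, P a → P b → P (a + b)) (hsmul : ∀ (c : ℚ) a, P a → P (c • a))
    (a : FreeCGA deg) : P a := by
  have ha : a ∈ Submodule.span ℚ (Set.range (word deg)) := by simp [span_word]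
  induction ha using Submodule.span_induction with
  | zero => exact h0
  | add x y _ _ hx hy => exact hadd x y hx hy
  | smul c x _ hx => exact hsmul c x hx
  | mem x hx =>
    obtain ⟨l, rfl⟩ := hx
    exact hw l

/-! ### Derivations of the free graded commutative algebra -/

section Derivation

variable {deg} (e : I → FreeCGA deg) (he : ∀ i, e i ∈ wordGr deg (deg i + 1))

/-- The representation by triangular matrices whose upper right corner is the derivation
prescribed by `e` on the generators. -/
def derMatrix : FreeCGA deg →ₐ[ℚ] Matrix (Fin 2) (Fin 2) (FreeCGA deg) :=
  -- A homogeneous `a` is to go to `!![(-1)^|a| a, d a; 0, a]`. The corner of a product is then the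
  -- graded Leibniz rule, and only the commutation relations between generators need checking.
  lift (fun i => !![(-1 : ℚ) ^ deg i • gen deg i, e i; 0, gen deg i]) (by
    intro i j
    have h1 := gen_mul_gen deg i j
    have h2 := mem_mul_comm deg (he i) (gen_mem deg j)
    have h3 := mem_mul_comm deg (he j) (gen_mem deg i)
    have h4 : gen deg i * e j = (-1 : ℚ) ^ ((deg j + 1) * deg i) • (e j * gen deg i) := by
      rw [h3, smul_smul, ← mul_pow]
      simp
    have s1 : (-1 : ℚ) ^ deg i * (-1) ^ ((deg j + 1) * deg i) = (-1) ^ (deg i * deg j) := by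
      rw [← pow_add, show deg i + (deg j + 1) * deg i = deg i * deg j + 2 * deg i by ring,
        pow_add, pow_mul (-1 : ℚ) 2]
      simp
    have s2 : (-1 : ℚ) ^ ((deg i + 1) * deg j) = (-1) ^ (deg i * deg j) * (-1) ^ deg j := by
      rw [← pow_add]
      congr 1
      ring
    ext r s
    fin_cases r <;> fin_cases s
    · simp [Matrix.mul_apply, h1, smul_smul, _root_.mul_comm, mul_left_comm, mul_assoc]
    · simp only [Matrix.mul_apply, Fin.sum_univ_two, Matrix.smul_apply]
      simp [h2, h4, smul_smul, s1, s2, add_comm]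
    · simp [Matrix.mul_apply]
    · simpa [Matrix.mul_apply] using h1)

/-- The derivation of degree one prescribed on the generators. -/
def der : FreeCGA deg →ₗ[ℚ] FreeCGA deg where
  toFun a := derMatrix e he a 0 1
  map_add' a b := by simp
  map_smul' c a := by simp

theorem derMatrix_lower (a : FreeCGA deg) : derMatrix e he a 1 0 = 0 ∧
    derMatrix e he a 1 1 = a := by
  induction a using word_induction with
  | hw l =>
    induction l with
    | nil => simp
    | cons i l ih =>
      rw [word_cons, map_mul, Matrix.mul_apply, Matrix.mul_apply, Fin.sum_univ_two,
        Fin.sum_univ_two, ih.1, ih.2]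
      simp [derMatrix]
  | h0 => simp
  | hadd a b ha hb => simp [ha, hb]
  | hsmul c a ha => simp [ha]

theorem derMatrix_upper {n : ℕ} {a : FreeCGA deg} (ha : a ∈ wordGr deg n) :
    derMatrix e he a 0 0 = (-1 : ℚ) ^ n • a := by
  induction ha using Submodule.span_induction with
  | zero => simp
  | add x y _ _ hx hy => simp [hx, hy]
  | smul c x _ hx => rw [map_smul, Matrix.smul_apply, hx, smul_comm]
  | mem x hx =>
    obtain ⟨l, rfl, rfl⟩ := hx
    induction l with
    | nil => simp
    | cons i l ih =>
      have := (derMatrix_lower e he (word deg l)).1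
      rw [word_cons, map_mul, Matrix.mul_apply, Fin.sum_univ_two, ih, this]
      simp [derMatrix, smul_smul, pow_add, _root_.mul_comm ((-1 : ℚ) ^ deg i)]

@[simp]
theorem der_gen (i : I) : der e he (gen deg i) = e i := by
  simp [der, derMatrix]

theorem der_mul {n : ℕ} {a : FreeCGA deg} (ha : a ∈ wordGr deg n) (b : FreeCGA deg) :
    der e he (a * b) = der e he a * b + (-1 : ℚ) ^ n • (a * der e he b) := by
  change derMatrix e he (a * b) 0 1 = derMatrix e he a 0 1 * b +
    (-1 : ℚ) ^ n • (a * derMatrix e he b 0 1)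
  rw [map_mul, Matrix.mul_apply, Fin.sum_univ_two, derMatrix_upper e he ha,
    (derMatrix_lower e he b).2, smul_mul_assoc, add_comm]

@[simp]
theorem der_one : der e he 1 = 0 := by
  change derMatrix e he 1 0 1 = 0
  simp

theorem der_mem {n : ℕ} {a : FreeCGA deg} (ha : a ∈ wordGr deg n) :
    der e he a ∈ wordGr deg (n + 1) := by
  induction ha using Submodule.span_induction with
  | zero => simp
  | add x y _ _ hx hy => rw [map_add]; exact add_mem hx hy
  | smul c x _ hx => rw [map_smul]; exact Submodule.smul_mem _ _ hx
  | mem x hx =>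
    obtain ⟨l, rfl, rfl⟩ := hx
    induction l with
    | nil => simp
    | cons i l ih =>
      rw [word_cons, der_mul e he (gen_mem deg i), der_gen, wordDeg_cons]
      refine add_mem ?_ (Submodule.smul_mem _ _ ?_)
      · have := SetLike.mul_mem_graded (he i) (word_mem deg l)
        rwa [add_right_comm] at this
      · have := SetLike.mul_mem_graded (gen_mem deg i) ih
        rwa [← add_assoc] at this

/-- By induction on words: for a letter `x` and a word `w` the two terms `d x * d w` carry opposite
signs. -/
theorem der_der (hd : ∀ i, der e he (e i) = 0) (a : FreeCGA deg) :
    der e he (der e he a) = 0 := by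
  induction a using word_induction with
  | hw l =>
    induction l with
    | nil => simp
    | cons i l ih =>
      rw [word_cons, der_mul e he (gen_mem deg i), der_gen, map_add, map_smul,
        der_mul e he (he i), der_mul e he (gen_mem deg i), der_gen, hd, ih, pow_succ,
        smul_add, smul_smul, ← mul_pow]
      simp only [mul_neg, mul_one, zero_mul, mul_zero, smul_zero, add_zero, zero_add]
      rw [← add_smul, neg_add_cancel, zero_smul]
  | h0 => simp
  | hadd a b ha hb => simp [ha, hb]
  | hsmul c a ha => simp [ha]

end Derivation

end FreeCGA

/-! ### Free algebras as CDGAs, and morphisms out of them -/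

open FreeCGA

/-- The free graded commutative algebra with the differential prescribed on the generators. -/
def free {I : Type v} {deg : I → ℕ} (e : I → FreeCGA deg)
    (he : ∀ i, e i ∈ FreeCGA.wordGr deg (deg i + 1)) (hd : ∀ i, der e he (e i) = 0) : CDGA.{v} where
  carrier := FreeCGA deg
  gr := FreeCGA.wordGr deg
  d := der e he
  d_mem := der_mem e he
  d_d := der_der e he hd
  d_mul := der_mul e he
  mul_comm := mem_mul_comm deg

theorem toCDGA_gen {I : Type v} {deg : I → ℕ} {B : CDGA.{u}} (y : I → B)
    (hy : ∀ i, y i ∈ B.gr (deg i)) (i : I) : FreeCGA.toCDGA deg B y hy (gen deg i) = y i := by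
  simp [FreeCGA.toCDGA, gen]

theorem d_one (B : CDGA.{u}) : B.d 1 = 0 := by
  have h := B.d_mul (SetLike.GradedOne.one_mem (A := B.gr)) 1
  simpa using h

theorem toCDGA_mem {I : Type v} {deg : I → ℕ} {B : CDGA.{u}} (y : I → B)
    (hy : ∀ i, y i ∈ B.gr (deg i)) {n : ℕ} {a : FreeCGA deg} (ha : a ∈ FreeCGA.wordGr deg n) :
    FreeCGA.toCDGA deg B y hy a ∈ B.gr n := by
  induction ha using Submodule.span_induction with
  | zero => rw [map_zero]; exact zero_mem _
  | add a b _ _ ha hb => rw [map_add]; exact add_mem ha hb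
  | smul c a _ ha => rw [map_smul]; exact Submodule.smul_mem _ _ ha
  | mem a ha =>
    obtain ⟨l, rfl, rfl⟩ := ha
    induction l with
    | nil =>
      rw [word_nil, map_one]
      exact SetLike.GradedOne.one_mem
    | cons i l ih =>
      rw [word_cons, map_mul, wordDeg_cons, toCDGA_gen]
      exact SetLike.mul_mem_graded (hy i) ih

section

variable {I : Type v} {deg : I → ℕ} (e : I → FreeCGA deg)
  (he : ∀ i, e i ∈ FreeCGA.wordGr deg (deg i + 1))

theorem toCDGA_der {B : CDGA.{u}} (y : I → B) (hy : ∀ i, y i ∈ B.gr (deg i))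
    (hdy : ∀ i, FreeCGA.toCDGA deg B y hy (e i) = B.d (y i)) (a : FreeCGA deg) :
    FreeCGA.toCDGA deg B y hy (der e he a) = B.d (FreeCGA.toCDGA deg B y hy a) := by
  induction a using word_induction with
  | hw l =>
    induction l with
    | nil => rw [word_nil, der_one, map_one, map_zero, d_one]
    | cons i l ih =>
      rw [word_cons, der_mul e he (gen_mem deg i), der_gen, map_add, map_mul, map_smul, map_mul,
        ih, map_mul, toCDGA_gen, B.d_mul (hy i), hdy]
  | h0 => simp
  | hadd a b ha hb => simp only [map_add, ha, hb]
  | hsmul c a ha => simp only [map_smul, ha]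

/-- Morphisms out of a free algebra with a differential are prescribed on the generators. -/
def freeLift (hd : ∀ i, der e he (e i) = 0) {B : CDGA.{u}} (y : I → B)
    (hy : ∀ i, y i ∈ B.gr (deg i)) (hdy : ∀ i, FreeCGA.toCDGA deg B y hy (e i) = B.d (y i)) :
    Hom (free e he hd) B where
  toAlgHom := FreeCGA.toCDGA deg B y hy
  map_mem := toCDGA_mem y hy
  map_d := toCDGA_der e he y hy hdy

end

/-! ### Homotopic morphisms agree on cocycles in degrees without coboundaries -/

open Polynomial

/-- The integral of a polynomial over the unit interval. -/
def unitIntegral : ℚ[X] →ₗ[ℚ] ℚ :=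
  Polynomial.lsum fun n => ((n : ℚ) + 1)⁻¹ • LinearMap.id

theorem unitIntegral_derivative (p : ℚ[X]) :
    unitIntegral (derivative p) = p.eval 1 - p.eval 0 := by
  induction p using Polynomial.induction_on' with
  | add p q hp hq => simp only [map_add, hp, hq, eval_add]; ring
  | monomial n c =>
    rw [derivative_monomial, unitIntegral, lsum_apply, sum_monomial_index _ _ (by simp)]
    rcases n with _ | n
    · simp
    · have : (n : ℚ) + 1 ≠ 0 := by positivity
      simp
      field_simp

/-- Integration of forms over the unit interval. -/
def pathIntegral : pathAlgebra →ₗ[ℚ] ℚ where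
  toFun w := unitIntegral (TrivSqZeroExt.snd (R := ℚ[X]) (M := ℚ[X]) w)
  map_add' a b := (congrArg unitIntegral (TrivSqZeroExt.snd_add a b)).trans (map_add _ _ _)
  map_smul' c a := (congrArg unitIntegral (TrivSqZeroExt.snd_smul c a)).trans (map_smul _ _ _)

/-- Integration over the fibre `B ⊗ Λ(t, dt) → B`. -/
def fibreIntegral (B : CDGA.{u}) : Tensor B pathAlgebra →ₗ[ℚ] B :=
  (TensorProduct.rid ℚ B).toLinearMap ∘ₗ TensorProduct.map LinearMap.id pathIntegral ∘ₗ
    (GradedTensorProduct.of ℚ B.gr pathAlgebra.gr).symm.toLinearMap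

theorem fibreIntegral_tmul (B : CDGA.{u}) (b : B) (w : pathAlgebra) :
    fibreIntegral B (GradedTensorProduct.tmul ℚ b w) =
      pathIntegral w • b := by
  simp [fibreIntegral]

/-- Stokes' formula for the fibre `[0, 1]`. Total degree `m + 1` consists of terms `b ⊗ p` with `|b|
= m + 1` and `b ⊗ q dt` with `|b| = m`. The hypothesis removes the second kind, and from the first
only `b ⊗ p' dt` survives integration. -/
theorem fibreIntegral_tensorD {B : CDGA.{u}} {m : ℕ} (hB : B.gr m = ⊥)
    {X : Tensor B pathAlgebra} (hX : X ∈ tensorGr B pathAlgebra (m + 1)) :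
    fibreIntegral B (tensorD B pathAlgebra X) =
      (-1 : ℚ) ^ (m + 1) • (tensorEval B 1 X - tensorEval B 0 X) := by
  rw [tensorGr] at hX
  induction hX using Submodule.span_induction with
  | zero => simp
  | add x y _ _ hx hy => simp only [map_add, hx, hy, ← smul_add]; congr 1; abel
  | smul c x _ hx => simp only [map_smul, hx, ← smul_sub]; rw [smul_comm]
  | mem x hx =>
    obtain ⟨i, j, hij, b, hb, w, hw, rfl⟩ := hx
    obtain ⟨h1, h2⟩ := Ltdt.mem_gr.1 hw
    rcases Nat.eq_zero_or_pos j with rfl | hj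
    · obtain rfl : i = m + 1 := by omega
      have hw0 : pathIntegral w = 0 := (congrArg unitIntegral (h2 (by omega))).trans (map_zero _)
      rw [tensorD_tmul B _ hb, map_add, map_smul, fibreIntegral_tmul, fibreIntegral_tmul,
        tensorEval_tmul, tensorEval_tmul, hw0, zero_smul, zero_add, ← sub_smul]
      congr 2
      exact unitIntegral_derivative _
    · rcases Nat.lt_or_ge 1 j with hj' | hj'
      · obtain rfl : w = 0 := TrivSqZeroExt.ext (h1 (by omega)) (h2 (by omega))
        have h0 : GradedTensorProduct.tmul ℚ b (0 : pathAlgebra) = (0 : Tensor B pathAlgebra) := by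
          rw [GradedTensorProduct.tmul, TensorProduct.tmul_zero, map_zero]
        rw [h0, map_zero, map_zero, map_zero, map_zero, sub_zero, smul_zero]
      · obtain rfl : i = m := by omega
        rw [hB, Submodule.mem_bot] at hb
        subst hb
        have h0 : GradedTensorProduct.tmul ℚ (0 : B) w = (0 : Tensor B pathAlgebra) := by
          rw [GradedTensorProduct.tmul, TensorProduct.zero_tmul, map_zero]
        rw [h0, map_zero, map_zero, map_zero, map_zero, sub_zero, smul_zero]

/-- For a cocycle, Stokes' formula integrates `H (d a) = 0`, so the end values of `H a` coincide. -/
theorem Homotopic.apply_eq {A : CDGA.{u}} {B : CDGA.{v}} {f g : Hom A B} (h : Homotopic f g)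
    {m : ℕ} (hB : B.gr m = ⊥) {a : A} (ha : a ∈ A.gr (m + 1)) (hda : A.d a = 0) :
    f.toAlgHom a = g.toAlgHom a := by
  obtain ⟨H, h1, h2, h3, h4⟩ := h
  have h := fibreIntegral_tensorD hB (h1 _ a ha)
  rw [← h2, hda, map_zero, map_zero, h3, h4, eq_comm, smul_eq_zero] at h
  exact (sub_eq_zero.1 (h.resolve_left (by simp))).symm

namespace Rigid

/-! ### Arithmetic of the degrees -/

/-- Since `7 (3k+1) - 3 (7k+2) = 1`, two representations of an integer differ by a multiple of
`(7k+2, -(3k+1))`. Starting from `i₀ < 0`, a positive multiple is needed to reach `i ≥ 0`, and it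
pushes `j` below `0`. -/
theorem not_representable {k i j : ℕ} {i₀ j₀ : ℤ} (hi : i₀ < 0) (hj : j₀ < 3 * k + 1) :
    (i * (3 * k + 1) + j * (7 * k + 2) : ℤ) ≠ i₀ * (3 * k + 1) + j₀ * (7 * k + 2) := by
  intro h
  have h1 : j₀ - j = (3 * k + 1) * (7 * (j₀ - j) - 3 * (i - i₀)) := by linear_combination 3 * h
  have h2 : i - i₀ = (7 * k + 2) * (7 * (j₀ - j) - 3 * (i - i₀)) := by linear_combination 7 * h
  have h3 : 0 < 7 * (j₀ - j) - 3 * (i - i₀) := by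
    by_contra hc
    have : (i : ℤ) - i₀ ≤ 0 := by
      rw [h2]
      exact mul_nonpos_of_nonneg_of_nonpos (by positivity) (by omega)
    omega
  nlinarith

theorem not_gap {k S i j : ℕ} (hS : S = i * (3 * k + 1) + j * (7 * k + 2)) (i₀ j₀ : ℤ)
    (hi : i₀ < 0) (hj : j₀ < 3 * k + 1) {n : ℕ} (hn : n = S)
    (h : (n : ℤ) = i₀ * (3 * k + 1) + j₀ * (7 * k + 2)) : False := by
  subst hn hS
  push_cast at h
  exact not_representable hi hj h

theorem small_values {k S i j : ℕ} (hk : 4 ≤ k) (hS : S = i * (3 * k + 1) + j * (7 * k + 2)) :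
    (S = 0 → i + j = 0) ∧ (S = 3 * k + 1 → i + j = 1) ∧ (S = 7 * k + 2 → i + j = 1) := by
  have hj : j ≤ 1 ∨ 2 * (7 * k + 2) ≤ j * (7 * k + 2) :=
    (Nat.lt_or_ge 1 j).symm.imp id fun h => Nat.mul_le_mul_right _ h
  have hi : i ≤ 2 ∨ 3 * (3 * k + 1) ≤ i * (3 * k + 1) :=
    (Nat.lt_or_ge 2 i).symm.imp id fun h => Nat.mul_le_mul_right _ h
  refine ⟨fun h => ?_, fun h => ?_, fun h => ?_⟩ <;>
  · rcases hj with hj | hj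
    · rcases hi with hi | hi
      · interval_cases i <;> interval_cases j <;> omega
      · interval_cases j <;> omega
    · omega

/-- The total degree of a word with prescribed numbers of letters. -/
def total (k i j a b c d e f : ℕ) : ℕ :=
  i * (6 * k + 2) + j * (14 * k + 4) + a * (14 * k ^ 2 + 6 * k + 1) +
    b * (14 * k ^ 2 + 8 * k + 1) + c * (28 * k ^ 2 + 20 * k + 3) + d * (28 * k ^ 2 + 28 * k + 5) +
    e * (42 * k ^ 2 + 26 * k + 3) + f * (42 * k ^ 2 + 28 * k + 3)

/-- The odd degrees exceed `14k²` times the weights 1, 1, 2, 2, 3, 3. Weight four already costs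
`56k²`, more than the degree of `t`, the largest one needed. -/
theorem odd_weight_le {k : ℕ} (hk : 4 ≤ k) {i j a b c d e f : ℕ}
    (h : total k i j a b c d e f ≤ 42 * k ^ 2 + 28 * k + 3) :
    a + b + 2 * c + 2 * d + 3 * e + 3 * f ≤ 3 := by
  by_contra hc
  have h1 : 14 * k ^ 2 * (a + b + 2 * c + 2 * d + 3 * e + 3 * f) ≤ total k i j a b c d e f := by
    have : total k i j a b c d e f = 14 * k ^ 2 * (a + b + 2 * c + 2 * d + 3 * e + 3 * f) +
        (i * (6 * k + 2) + j * (14 * k + 4) + a * (6 * k + 1) + b * (8 * k + 1) +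
          c * (20 * k + 3) + d * (28 * k + 5) + e * (26 * k + 3) + f * (28 * k + 3)) := by
      unfold total
      ring
    omega
  have h2 : 14 * k ^ 2 * 4 ≤ 14 * k ^ 2 * (a + b + 2 * c + 2 * d + 3 * e + 3 * f) :=
    Nat.mul_le_mul_left _ (by omega)
  nlinarith

theorem cases_of_weight {a b c d e f : ℕ} (h : a + b + 2 * c + 2 * d + 3 * e + 3 * f ≤ 3) :
    (a, b, c, d, e, f) ∈ [(0, 0, 0, 0, 0, 0), (1, 0, 0, 0, 0, 0), (2, 0, 0, 0, 0, 0),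
      (3, 0, 0, 0, 0, 0), (0, 1, 0, 0, 0, 0), (1, 1, 0, 0, 0, 0), (2, 1, 0, 0, 0, 0),
      (0, 2, 0, 0, 0, 0), (1, 2, 0, 0, 0, 0), (0, 3, 0, 0, 0, 0), (0, 0, 1, 0, 0, 0),
      (1, 0, 1, 0, 0, 0), (0, 1, 1, 0, 0, 0), (0, 0, 0, 1, 0, 0), (1, 0, 0, 1, 0, 0),
      (0, 1, 0, 1, 0, 0), (0, 0, 0, 0, 1, 0), (0, 0, 0, 0, 0, 1)] := by
  rcases e with _ | e
  · rcases f with _ | f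
    · rcases c with _ | c
      · rcases d with _ | d
        · have ha : a ≤ 3 := by omega
          have hb : b ≤ 3 := by omega
          interval_cases a <;> interval_cases b <;> first | omega | simp
        · obtain rfl : d = 0 := by omega
          have ha : a ≤ 1 := by omega
          have hb : b ≤ 1 := by omega
          interval_cases a <;> interval_cases b <;> first | omega | simp
      · obtain ⟨rfl, rfl⟩ : c = 0 ∧ d = 0 := by omega
        have ha : a ≤ 1 := by omega
        have hb : b ≤ 1 := by omega
        interval_cases a <;> interval_cases b <;> first | omega | simp
    · obtain ⟨rfl, rfl, rfl, rfl, rfl⟩ : a = 0 ∧ b = 0 ∧ c = 0 ∧ d = 0 ∧ f = 0 := by omega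
      simp
  · obtain ⟨rfl, rfl, rfl, rfl, rfl, rfl⟩ :
      a = 0 ∧ b = 0 ∧ c = 0 ∧ d = 0 ∧ e = 0 ∧ f = 0 := by omega
    simp

-- Here `i, j` count the letters `b` and `x g`, and `a, …, f` count `u, v, y, z, s, t`. The values
-- of `D` are the degrees of the generators and the degrees one below the closed ones. Fixing the
-- odd letters determines the half-degree `S` of the even part; what parity, size and `small_values`
-- do not settle asks `S` to be a gap of the semigroup generated by `3k+1` and `7k+2`.
set_option maxHeartbeats 4000000 in
theorem total_cases {k : ℕ} (hk : 4 ≤ k) {i j a b c d e f D : ℕ}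
    (h : total k i j a b c d e f = D)
    (hD : D = 14 * k + 4 ∨ D = 6 * k + 2 ∨ D = 14 * k ^ 2 + 6 * k + 1 ∨
      D = 14 * k ^ 2 + 8 * k + 1 ∨ D = 28 * k ^ 2 + 20 * k + 3 ∨ D = 28 * k ^ 2 + 28 * k + 5 ∨
      D = 42 * k ^ 2 + 26 * k + 3 ∨ D = 42 * k ^ 2 + 28 * k + 3 ∨ D = 14 * k + 3 ∨ D = 6 * k + 1 ∨
      D = 14 * k ^ 2 + 6 * k ∨ D = 14 * k ^ 2 + 8 * k) :
    i + j + a + b + c + d + e + f = 1 ∧ D ≠ 14 * k + 3 ∧ D ≠ 6 * k + 1 ∧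
      D ≠ 14 * k ^ 2 + 6 * k ∧ D ≠ 14 * k ^ 2 + 8 * k := by
  have hK : 4 * k ≤ k ^ 2 := by nlinarith
  have hw : a + b + 2 * c + 2 * d + 3 * e + 3 * f ≤ 3 :=
    odd_weight_le hk (i := i) (j := j) (by rw [h]; omega)
  obtain ⟨S, hS⟩ : ∃ S, S = i * (3 * k + 1) + j * (7 * k + 2) := ⟨_, rfl⟩
  obtain ⟨h0, h1, h2⟩ := small_values hk hS
  -- Each gap equals `i₀ (3k+1) + j₀ (7k+2)` for the two integers supplied. The bound `j₀ < 3k+1` is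
  -- tightest for `j₀ = 2k+4` in `g17`, which needs `k ≥ 4`. In `g7` and `g8` the summands on the
  -- left avoid truncated subtraction.
  have g1 : ∀ n, n = S → n ≠ k := fun n hn h =>
    not_gap hS (-2) 1 (by norm_num) (by omega) hn (by zify at h; linear_combination h)
  have g2 : ∀ n, n = S → n ≠ 2 * k := fun n hn h =>
    not_gap hS (-4) 2 (by norm_num) (by omega) hn (by zify at h; linear_combination h)
  have g3 : ∀ n, n = S → n ≠ 3 * k := fun n hn h =>
    not_gap hS (-6) 3 (by norm_num) (by omega) hn (by zify at h; linear_combination h)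
  have g4 : ∀ n, n = S → n ≠ 4 * k := fun n hn h =>
    not_gap hS (-8) 4 (by norm_num) (by omega) hn (by zify at h; linear_combination h)
  have g5 : ∀ n, n = S → n ≠ 4 * k + 1 := fun n hn h =>
    not_gap hS (-1) 1 (by norm_num) (by omega) hn (by zify at h; linear_combination h)
  have g6 : ∀ n, n = S → n ≠ 5 * k := fun n hn h =>
    not_gap hS (-10) 5 (by norm_num) (by omega) hn (by zify at h; linear_combination h)
  have g7 : ∀ n, n = S → n + k + 1 ≠ 7 * k ^ 2 := fun n hn h =>
    not_gap hS (-1) k (by norm_num) (by omega) hn (by zify at h; linear_combination h)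
  have g8 : ∀ n, n = S → n + 1 ≠ 7 * k ^ 2 := fun n hn h =>
    not_gap hS (-3) (k + 1) (by norm_num) (by omega) hn (by zify at h; linear_combination h)
  have g9 : ∀ n, n = S → n ≠ 7 * k ^ 2 + 3 * k := fun n hn h =>
    not_gap hS (-2) (k + 1) (by norm_num) (by omega) hn (by zify at h; linear_combination h)
  have g10 : ∀ n, n = S → n ≠ 7 * k ^ 2 + 4 * k := fun n hn h =>
    not_gap hS (-4) (k + 2) (by norm_num) (by omega) hn (by zify at h; linear_combination h)
  have g11 : ∀ n, n = S → n ≠ 7 * k ^ 2 + 6 * k + 1 := fun n hn h =>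
    not_gap hS (-1) (k + 1) (by norm_num) (by omega) hn (by zify at h; linear_combination h)
  have g12 : ∀ n, n = S → n ≠ 7 * k ^ 2 + 7 * k + 1 := fun n hn h =>
    not_gap hS (-3) (k + 2) (by norm_num) (by omega) hn (by zify at h; linear_combination h)
  have g13 : ∀ n, n = S → n ≠ 7 * k ^ 2 + 10 * k + 2 := fun n hn h =>
    not_gap hS (-2) (k + 2) (by norm_num) (by omega) hn (by zify at h; linear_combination h)
  have g14 : ∀ n, n = S → n ≠ 7 * k ^ 2 + 11 * k + 2 := fun n hn h =>
    not_gap hS (-4) (k + 3) (by norm_num) (by omega) hn (by zify at h; linear_combination h)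
  have g15 : ∀ n, n = S → n ≠ 14 * k ^ 2 + 9 * k + 1 := fun n hn h =>
    not_gap hS (-3) (2 * k + 2) (by norm_num) (by omega) hn (by zify at h; linear_combination h)
  have g16 : ∀ n, n = S → n ≠ 14 * k ^ 2 + 10 * k + 1 := fun n hn h =>
    not_gap hS (-5) (2 * k + 3) (by norm_num) (by omega) hn (by zify at h; linear_combination h)
  have g17 : ∀ n, n = S → n ≠ 14 * k ^ 2 + 11 * k + 1 := fun n hn h =>
    not_gap hS (-7) (2 * k + 4) (by norm_num) (by omega) hn (by zify at h; linear_combination h)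
  have hT : 2 * S + (a * (14 * k ^ 2 + 6 * k + 1) +
    b * (14 * k ^ 2 + 8 * k + 1) + c * (28 * k ^ 2 + 20 * k + 3) + d * (28 * k ^ 2 + 28 * k + 5) +
    e * (42 * k ^ 2 + 26 * k + 3) + f * (42 * k ^ 2 + 28 * k + 3)) = D := by
    rw [← h, hS, total]
    ring
  clear h hS
  have hcases := cases_of_weight hw
  clear hw
  simp only [List.mem_cons, List.not_mem_nil, or_false, Prod.mk.injEq] at hcases
  -- With `k ^ 2` an atom subject to `4 * k ≤ K`, everything that remains is linear.
  generalize k ^ 2 = K at *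
  rcases hcases with ⟨rfl, rfl, rfl, rfl, rfl, rfl⟩ | ⟨rfl, rfl, rfl, rfl, rfl, rfl⟩ |
    ⟨rfl, rfl, rfl, rfl, rfl, rfl⟩ | ⟨rfl, rfl, rfl, rfl, rfl, rfl⟩ |
    ⟨rfl, rfl, rfl, rfl, rfl, rfl⟩ | ⟨rfl, rfl, rfl, rfl, rfl, rfl⟩ |
    ⟨rfl, rfl, rfl, rfl, rfl, rfl⟩ | ⟨rfl, rfl, rfl, rfl, rfl, rfl⟩ |
    ⟨rfl, rfl, rfl, rfl, rfl, rfl⟩ | ⟨rfl, rfl, rfl, rfl, rfl, rfl⟩ |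
    ⟨rfl, rfl, rfl, rfl, rfl, rfl⟩ | ⟨rfl, rfl, rfl, rfl, rfl, rfl⟩ |
    ⟨rfl, rfl, rfl, rfl, rfl, rfl⟩ | ⟨rfl, rfl, rfl, rfl, rfl, rfl⟩ |
    ⟨rfl, rfl, rfl, rfl, rfl, rfl⟩ | ⟨rfl, rfl, rfl, rfl, rfl, rfl⟩ |
    ⟨rfl, rfl, rfl, rfl, rfl, rfl⟩ | ⟨rfl, rfl, rfl, rfl, rfl, rfl⟩ <;>
  simp only [zero_mul, one_mul, add_zero, zero_add] at hT ⊢ <;>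
  rcases hD with rfl | rfl | rfl | rfl | rfl | rfl | rfl | rfl | rfl | rfl | rfl | rfl <;>
  first
  | omega
  | exact (g1 _ rfl (by omega)).elim
  | exact (g2 _ rfl (by omega)).elim
  | exact (g3 _ rfl (by omega)).elim
  | exact (g4 _ rfl (by omega)).elim
  | exact (g5 _ rfl (by omega)).elim
  | exact (g6 _ rfl (by omega)).elim
  | exact (g7 _ rfl (by omega)).elim
  | exact (g8 _ rfl (by omega)).elim
  | exact (g9 _ rfl (by omega)).elim
  | exact (g10 _ rfl (by omega)).elim
  | exact (g11 _ rfl (by omega)).elim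
  | exact (g12 _ rfl (by omega)).elim
  | exact (g13 _ rfl (by omega)).elim
  | exact (g14 _ rfl (by omega)).elim
  | exact (g15 _ rfl (by omega)).elim
  | exact (g16 _ rfl (by omega)).elim
  | exact (g17 _ rfl (by omega)).elim

end Rigid

/-! ### Cocycles and homogeneous products -/

namespace FreeCGA

variable {I : Type v} {deg : I → ℕ} (e : I → FreeCGA deg) (he : ∀ i, e i ∈ wordGr deg (deg i + 1))

/-- The cocycles form a subalgebra. -/
def cocycles : Subalgebra ℚ (FreeCGA deg) where
  carrier := {a | der e he a = 0}
  mul_mem' := by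
    intro a b ha hb
    -- Reading `d` as a matrix corner makes this work for inhomogeneous elements too, without signs.
    change derMatrix e he a 0 1 = 0 at ha
    change derMatrix e he b 0 1 = 0 at hb
    change derMatrix e he (a * b) 0 1 = 0
    rw [map_mul, Matrix.mul_apply, Fin.sum_univ_two, ha, hb]
    simp
  add_mem' := by
    intro a b ha hb
    simp only [Set.mem_ofPred_eq] at ha hb ⊢
    rw [map_add, ha, hb, add_zero]
  algebraMap_mem' := by
    intro r
    simp only [Set.mem_ofPred_eq]
    rw [Algebra.algebraMap_eq_smul_one, map_smul, der_one, smul_zero]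

theorem mem_cocycles {a : FreeCGA deg} : a ∈ cocycles e he ↔ der e he a = 0 := Iff.rfl

theorem gen_mem_cocycles {i : I} (h : e i = 0) : gen deg i ∈ cocycles e he := by
  rw [mem_cocycles, der_gen, h]

theorem gen_mul_self {i : I} (h : Odd (deg i)) : gen deg i * gen deg i = 0 := by
  have h1 := gen_mul_gen deg i i
  rw [(h.mul h).neg_one_pow] at h1
  have h2 : (2 : ℚ) • (gen deg i * gen deg i) = 0 :=
    calc (2 : ℚ) • (gen deg i * gen deg i)
        = (1 : ℚ) • (gen deg i * gen deg i) + (-1 : ℚ) • (gen deg i * gen deg i) := by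
          rw [two_smul, one_smul, ← h1]
      _ = 0 := by rw [← add_smul, add_neg_cancel, zero_smul]
  exact (smul_eq_zero.1 h2).resolve_left two_ne_zero

theorem pow_mem {n : ℕ} {a : FreeCGA deg} (ha : a ∈ wordGr deg n) {r m : ℕ} (h : r * n = m) :
    a ^ r ∈ wordGr deg m := by
  have := SetLike.pow_mem_graded r ha
  rwa [smul_eq_mul, h] at this

theorem mul_mem {n m r : ℕ} {a b : FreeCGA deg} (ha : a ∈ wordGr deg n) (hb : b ∈ wordGr deg m)
    (h : n + m = r) : a * b ∈ wordGr deg r :=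
  h ▸ SetLike.mul_mem_graded ha hb

end FreeCGA

namespace Rigid

open FreeCGA

/-! ### The rigid algebra attached to a finite group -/

/-- The generators: `x g` and `z g` for the elements of the group, and six others. -/
inductive Gen (G : Type) : Type
  | x (g : G)
  | b
  | u
  | v
  | y
  | z (g : G)
  | s
  | t

variable {G : Type}

/-- The degrees of the generators. -/
def deg (k : ℕ) : Gen G → ℕ
  | .x _ => 14 * k + 4
  | .b => 6 * k + 2
  | .u => 14 * k ^ 2 + 6 * k + 1
  | .v => 14 * k ^ 2 + 8 * k + 1
  | .y => 28 * k ^ 2 + 20 * k + 3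
  | .z _ => 28 * k ^ 2 + 28 * k + 5
  | .s => 42 * k ^ 2 + 26 * k + 3
  | .t => 42 * k ^ 2 + 28 * k + 3

theorem exists_total (k : ℕ) (l : List (Gen G)) : ∃ i j a b c d e f,
    wordDeg (deg k) l = total k i j a b c d e f ∧ l.length = i + j + a + b + c + d + e + f := by
  induction l with
  | nil => exact ⟨0, 0, 0, 0, 0, 0, 0, 0, by simp [total], rfl⟩
  | cons g l ih =>
    obtain ⟨i, j, a, b, c, d, e, f, h1, h2⟩ := ih
    rw [wordDeg_cons, List.length_cons, h1, h2]
    cases g with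
    | x g => exact ⟨i, j + 1, a, b, c, d, e, f, by simp only [total, deg]; ring, by ring⟩
    | b => exact ⟨i + 1, j, a, b, c, d, e, f, by simp only [total, deg]; ring, by ring⟩
    | u => exact ⟨i, j, a + 1, b, c, d, e, f, by simp only [total, deg]; ring, by ring⟩
    | v => exact ⟨i, j, a, b + 1, c, d, e, f, by simp only [total, deg]; ring, by ring⟩
    | y => exact ⟨i, j, a, b, c + 1, d, e, f, by simp only [total, deg]; ring, by ring⟩
    | z g => exact ⟨i, j, a, b, c, d + 1, e, f, by simp only [total, deg]; ring, by ring⟩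
    | s => exact ⟨i, j, a, b, c, d, e + 1, f, by simp only [total, deg]; ring, by ring⟩
    | t => exact ⟨i, j, a, b, c, d, e, f + 1, by simp only [total, deg]; ring, by ring⟩

theorem length_eq_one {k : ℕ} (hk : 4 ≤ k) {l : List (Gen G)} {i : Gen G}
    (h : wordDeg (deg k) l = deg k i) : l.length = 1 := by
  obtain ⟨_, _, _, _, _, _, _, _, h1, h2⟩ := exists_total k l
  rw [h2]
  refine (total_cases hk (h1.symm.trans h) ?_).1
  cases i <;> simp [deg]

/-- There are no decomposables in the degree of a generator; this is why endomorphisms are linear on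
generators. -/
theorem gr_deg_le {k : ℕ} (hk : 4 ≤ k) (i : Gen G) :
    wordGr (deg (G := G) k) (deg k i) ≤
      Submodule.span ℚ (gen (deg (G := G) k) '' {j : Gen G | deg k j = deg k i}) := by
  rw [wordGr, Submodule.span_le]
  rintro _ ⟨l, hl, rfl⟩
  obtain ⟨j, rfl⟩ := List.length_eq_one_iff.1 (length_eq_one hk hl)
  refine Submodule.subset_span ⟨j, ?_, by simp⟩
  simpa using hl

theorem gr_eq_bot_of_forall {I : Type} {δ : I → ℕ} {n : ℕ} (h : ∀ l, wordDeg δ l ≠ n) :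
    wordGr δ n = ⊥ := by
  rw [wordGr, Submodule.span_eq_bot]
  rintro _ ⟨l, hl, -⟩
  exact absurd hl (h l)

/-- The generators on which the differential vanishes. -/
def Gen.IsClosed : Gen G → Prop
  | .x _ | .b | .u | .v => True
  | _ => False

/-- Supplies the vanishing hypothesis of `Homotopic.apply_eq` at the closed generators. -/
theorem gr_pred_deg {k : ℕ} (hk : 4 ≤ k) {i : Gen G} (hi : i.IsClosed) :
    wordGr (deg (G := G) k) (deg k i - 1) = ⊥ := by
  apply gr_eq_bot_of_forall
  intro l h
  obtain ⟨_, _, _, _, _, _, _, _, h1, -⟩ := exists_total k l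
  rw [h1] at h
  cases i with
  | x g => exact (total_cases hk h (by simp [deg])).2.1 (by simp [deg])
  | b => exact (total_cases hk h (by simp [deg])).2.2.1 (by simp [deg])
  | u => exact (total_cases hk h (by simp [deg])).2.2.2.1 (by simp [deg])
  | v => exact (total_cases hk h (by simp [deg])).2.2.2.2 (by simp [deg])
  | y | z g | s | t => exact hi.elim

theorem six_mul_le_deg {k : ℕ} (hk : 4 ≤ k) (i : Gen G) : 6 * k + 2 ≤ deg k i := by
  have : 4 * k ≤ k ^ 2 := by nlinarith
  cases i <;> simp only [deg] <;> omega

theorem gr_eq_bot {k n : ℕ} (hk : 4 ≤ k) (h1 : 1 ≤ n) (h2 : n < 6 * k + 2) :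
    wordGr (deg (G := G) k) n = ⊥ := by
  apply gr_eq_bot_of_forall
  rintro (_ | ⟨i, l⟩) h
  · simp at h
    omega
  · have := six_mul_le_deg hk i
    rw [wordDeg_cons] at h
    omega

theorem odd_u (k : ℕ) : Odd (deg k (.u : Gen G)) :=
  ⟨7 * k ^ 2 + 3 * k, by simp only [deg]; ring⟩

theorem odd_v (k : ℕ) : Odd (deg k (.v : Gen G)) :=
  ⟨7 * k ^ 2 + 4 * k, by simp only [deg]; ring⟩

section Colour

variable [Fintype G]

/-- The colour of an element of the group. -/
def colour (g : G) : ℚ := (Fintype.equivFin G g : ℕ) + 1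

theorem colour_injective : Function.Injective (colour (G := G)) := by
  intro g h hgh
  have : ((Fintype.equivFin G g : ℕ) : ℚ) = (Fintype.equivFin G h : ℕ) := by
    simpa [colour] using hgh
  exact (Fintype.equivFin G).injective (Fin.ext (Nat.cast_injective this))

/-- The shift by one in `colour` is for this: the colour of `1` has to be cancelled when diagonal
entries are compared. -/
theorem colour_ne_zero (g : G) : colour g ≠ 0 := by
  unfold colour
  positivity

end Colour

variable [Group G] [Fintype G]

/-- The differential on the generators. -/
def dGen (k : ℕ) : Gen G → FreeCGA (deg (G := G) k)
  | .x _ | .b | .u | .v => 0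
  | .y => gen _ .u * gen _ .v * gen _ .b
  | .z g => gen _ .u * gen _ .v * ∑ h : G, colour (g⁻¹ * h) • gen _ (.x h) +
      gen _ .b * gen _ (.x g) ^ (2 * k + 1)
  -- Both powers have degree `2 (3k+1) (7k+2)`, so `d s` ties the scalar of `b` to those of the `x
  -- h`.
  | .s => gen _ .u * gen _ .y + gen _ .b ^ (7 * k + 2) + ∑ h : G, gen _ (.x h) ^ (3 * k + 1)
  | .t => gen _ .v * gen _ .y + gen _ .b ^ (7 * k) * ∑ h : G, gen _ (.x h)

theorem dGen_y (k : ℕ) : dGen k (.y : Gen G) = gen _ .u * gen _ .v * gen _ .b := rfl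

theorem dGen_z (k : ℕ) (g : G) : dGen k (.z g) =
    gen _ .u * gen _ .v * ∑ h : G, colour (g⁻¹ * h) • gen _ (.x h) +
      gen _ .b * gen _ (.x g) ^ (2 * k + 1) := rfl

theorem dGen_s (k : ℕ) : dGen k (.s : Gen G) = gen _ .u * gen _ .y + gen _ .b ^ (7 * k + 2) +
    ∑ h : G, gen _ (.x h) ^ (3 * k + 1) := rfl

theorem dGen_t (k : ℕ) : dGen k (.t : Gen G) = gen _ .v * gen _ .y +
    gen _ .b ^ (7 * k) * ∑ h : G, gen _ (.x h) := rfl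

theorem dGen_mem (k : ℕ) (i : Gen G) : dGen k i ∈ wordGr (deg k) (deg k i + 1) := by
  have hg := fun i : Gen G => gen_mem (deg k) i
  have hx : ∑ h : G, gen (deg k) (.x h) ∈ wordGr (deg k) (14 * k + 4) :=
    Submodule.sum_mem _ fun h _ => hg (.x h)
  cases i with
  | x g => exact zero_mem _
  | b => exact zero_mem _
  | u => exact zero_mem _
  | v => exact zero_mem _
  | y => exact mul_mem (mul_mem (hg .u) (hg .v) rfl) (hg .b) (by simp only [deg]; ring)
  | z g =>
    refine add_mem (mul_mem (mul_mem (hg .u) (hg .v) rfl) (m := 14 * k + 4)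
      (sum_mem fun h _ => Submodule.smul_mem _ _ (hg (.x h))) (by simp only [deg]; ring))
      (mul_mem (m := (2 * k + 1) * (14 * k + 4)) (hg .b) (pow_mem (hg (.x g)) rfl)
        (by simp only [deg]; ring))
  | s =>
    refine add_mem (add_mem (mul_mem (hg .u) (hg .y) (by simp only [deg]; ring))
      (pow_mem (hg .b) (by simp only [deg]; ring)))
      (sum_mem fun h _ => pow_mem (hg (.x h)) (by simp only [deg]; ring))
  | t =>
    have h1 : gen (deg k) (.v : Gen G) * gen (deg k) .y ∈ wordGr (deg k) (deg k (.t : Gen G) + 1) :=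
      mul_mem (hg .v) (hg .y) (by simp only [deg]; ring)
    have h2 : gen (deg k) (.b : Gen G) ^ (7 * k) ∈ wordGr (deg k) (7 * k * (6 * k + 2)) :=
      pow_mem (hg .b) (by simp only [deg])
    rw [dGen_t]
    exact add_mem h1 (mul_mem h2 hx (by simp only [deg]; ring))

theorem gen_mem_cocycles_of_isClosed (k : ℕ) {i : Gen G} (hi : i.IsClosed) :
    gen (deg k) i ∈ cocycles (dGen k) (dGen_mem k) := by
  apply gen_mem_cocycles
  cases i with
  | x g | b | u | v => rfl
  | y | z g | s | t => exact hi.elim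

/-- All terms are products of cocycles except `u y` and `v y`, whose differentials contain `u` or
`v` twice and vanish by oddness. -/
theorem der_dGen (k : ℕ) (i : Gen G) : der (dGen k) (dGen_mem k) (dGen k i) = 0 := by
  have hx : ∀ g : G, gen (deg k) (.x g) ∈ cocycles (dGen k) (dGen_mem k) :=
    fun g => gen_mem_cocycles_of_isClosed k trivial
  have hb : gen (deg k) (.b : Gen G) ∈ cocycles (dGen k) (dGen_mem k) :=
    gen_mem_cocycles_of_isClosed k trivial
  have hu : gen (deg k) (.u : Gen G) ∈ cocycles (dGen k) (dGen_mem k) :=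
    gen_mem_cocycles_of_isClosed k trivial
  have hv : gen (deg k) (.v : Gen G) ∈ cocycles (dGen k) (dGen_mem k) :=
    gen_mem_cocycles_of_isClosed k trivial
  rw [← mem_cocycles]
  cases i with
  | x g | b | u | v => exact zero_mem _
  | y => exact Subalgebra.mul_mem _ (Subalgebra.mul_mem _ hu hv) hb
  | z g =>
    rw [dGen_z]
    exact Subalgebra.add_mem _ (Subalgebra.mul_mem _ (Subalgebra.mul_mem _ hu hv)
      (Subalgebra.sum_mem _ fun h _ => Subalgebra.smul_mem _ (hx h) _))
      (Subalgebra.mul_mem _ hb (Subalgebra.pow_mem _ (hx g) _))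
  | s =>
    rw [dGen_s]
    refine Subalgebra.add_mem _ (Subalgebra.add_mem _ ?_ (Subalgebra.pow_mem _ hb _))
      (Subalgebra.sum_mem _ fun h _ => Subalgebra.pow_mem _ (hx h) _)
    rw [mem_cocycles, der_mul _ _ (gen_mem _ _), der_gen, der_gen, dGen_y,
      show dGen k (.u : Gen G) = 0 from rfl, zero_mul, zero_add,
      ← mul_assoc, ← mul_assoc, gen_mul_self (odd_u k)]
    simp
  | t =>
    rw [dGen_t]
    refine Subalgebra.add_mem _ ?_ (Subalgebra.mul_mem _ (Subalgebra.pow_mem _ hb _)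
      (Subalgebra.sum_mem _ fun h _ => hx h))
    rw [mem_cocycles, der_mul _ _ (gen_mem _ _), der_gen, der_gen, dGen_y,
      show dGen k (.v : Gen G) = 0 from rfl, zero_mul, zero_add,
      gen_mul_gen (deg k) Gen.u Gen.v, smul_mul_assoc, mul_smul_comm, ← mul_assoc, ← mul_assoc,
      gen_mul_self (odd_v k)]
    simp

variable (G) in
/-- The rigid algebra of the finite group `G` with parameter `k`. -/
def model (k : ℕ) : CDGA.{0} := free (dGen (G := G) k) (dGen_mem k) (der_dGen k)

/-! ### Coefficient extraction -/

section Detect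

variable {R : Type} [CommRing R]

/-- Left multiplication by `α θ₁ + β θ₂` on the exterior algebra on `θ₁, θ₂`, in the basis
`1, θ₁, θ₂, θ₁ θ₂`. -/
def oddMatrix (α β : R) : Matrix (Fin 4) (Fin 4) R :=
  !![0, 0, 0, 0; α, 0, 0, 0; β, 0, 0, 0; 0, -β, α, 0]

/-- Left multiplication by `r θ₁ θ₂` on the exterior algebra on `θ₁, θ₂`. -/
def topMatrix (r : R) : Matrix (Fin 4) (Fin 4) R :=
  !![0, 0, 0, 0; 0, 0, 0, 0; 0, 0, 0, 0; r, 0, 0, 0]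

/-- The determinant is antisymmetric, as the relation between two odd generators requires. -/
theorem oddMatrix_mul (a b c d : R) :
    oddMatrix a b * oddMatrix c d = topMatrix (a * d - b * c) := by
  ext i j
  fin_cases i <;> fin_cases j <;>
    simp [oddMatrix, topMatrix, Matrix.mul_apply, Fin.sum_univ_four]
  ring

theorem topMatrix_mul (r s : R) :
    topMatrix r * algebraMap R (Matrix (Fin 4) (Fin 4) R) s = topMatrix (r * s) := by
  ext i j
  rw [Matrix.algebraMap_eq_diagonal, Matrix.mul_diagonal]
  fin_cases i <;> fin_cases j <;> simp [topMatrix]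

theorem oddMatrix_zero : oddMatrix (0 : R) 0 = 0 := by
  ext i j
  fin_cases i <;> fin_cases j <;> simp [oddMatrix]

theorem topMatrix_neg (r : R) : topMatrix (-r) = -topMatrix r := by
  ext i j
  fin_cases i <;> fin_cases j <;> simp [topMatrix]

/-- Column `0` is the image of `1`, so its rows `0` and `3` hold the coefficients of `1` and `θ₁
θ₂`. -/
theorem topMatrix_add_zero (r s : R) : (topMatrix r + algebraMap R _ s) 0 0 = s := by
  simp [topMatrix, Matrix.algebraMap_eq_diagonal]

theorem topMatrix_add_three (r s : R) : (topMatrix r + algebraMap R _ s) 3 0 = r := by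
  simp [topMatrix, Matrix.algebraMap_eq_diagonal]

variable {G : Type}

/-- The images of the generators under the detecting homomorphism. -/
def detectGen (rx : G → R) (rb : R) (α β : Fin 3 → R) : Gen G → Matrix (Fin 4) (Fin 4) R
  | .x g => algebraMap R _ (rx g)
  | .b => algebraMap R _ rb
  | .u => oddMatrix (α 0) (β 0)
  | .v => oddMatrix (α 1) (β 1)
  | .y => oddMatrix (α 2) (β 2)
  | .z _ | .s | .t => 0

theorem even_or_odd (k : ℕ) (rx : G → R) (rb : R) (α β : Fin 3 → R) (i : Gen G) :
    (Even (deg k i) ∧ ∃ r, detectGen rx rb α β i = algebraMap R _ r) ∨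
      (Odd (deg k i) ∧ ∃ a b, detectGen rx rb α β i = oddMatrix a b) := by
  cases i with
  | x g => exact Or.inl ⟨⟨7 * k + 2, by simp only [deg]; ring⟩, _, rfl⟩
  | b => exact Or.inl ⟨⟨3 * k + 1, by simp only [deg]; ring⟩, _, rfl⟩
  | u => exact Or.inr ⟨odd_u k, _, _, rfl⟩
  | v => exact Or.inr ⟨odd_v k, _, _, rfl⟩
  | y => exact Or.inr ⟨⟨14 * k ^ 2 + 10 * k + 1, by simp only [deg]; ring⟩, _, _, rfl⟩
  | z g => exact Or.inr ⟨⟨14 * k ^ 2 + 14 * k + 2, by simp only [deg]; ring⟩, 0, 0,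
      oddMatrix_zero.symm⟩
  | s => exact Or.inr ⟨⟨21 * k ^ 2 + 13 * k + 1, by simp only [deg]; ring⟩, 0, 0,
      oddMatrix_zero.symm⟩
  | t => exact Or.inr ⟨⟨21 * k ^ 2 + 14 * k + 1, by simp only [deg]; ring⟩, 0, 0,
      oddMatrix_zero.symm⟩

variable [Algebra ℚ R]

theorem smul_oddMatrix (q : ℚ) (a b : R) : q • oddMatrix a b = oddMatrix (q • a) (q • b) := by
  ext i j
  fin_cases i <;> fin_cases j <;> simp [oddMatrix]

theorem smul_algebraMap (q : ℚ) (r : R) : q • algebraMap R (Matrix (Fin 4) (Fin 4) R) r =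
    algebraMap R (Matrix (Fin 4) (Fin 4) R) (q • r) := by
  ext i j
  simp [Matrix.algebraMap_eq_diagonal, Matrix.diagonal_apply, smul_ite]

/-- The homomorphism to the exterior algebra on two generators that detects coefficients. -/
def detect (k : ℕ) (rx : G → R) (rb : R) (α β : Fin 3 → R) :
    FreeCGA (deg (G := G) k) →ₐ[ℚ] Matrix (Fin 4) (Fin 4) R :=
  lift (detectGen rx rb α β) (by
    intro i j
    rcases even_or_odd k rx rb α β i with ⟨hi, r, hr⟩ | ⟨hi, a, b, hr⟩
    · rw [(hi.mul_right _).neg_one_pow, one_smul, hr]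
      exact Algebra.commutes _ _
    · rcases even_or_odd k rx rb α β j with ⟨hj, r, hr'⟩ | ⟨hj, c, d, hr'⟩
      · rw [(hj.mul_left _).neg_one_pow, one_smul, hr']
        exact (Algebra.commutes _ _).symm
      · rw [(hi.mul hj).neg_one_pow, hr, hr', oddMatrix_mul, oddMatrix_mul, neg_one_smul,
          ← topMatrix_neg]
        congr 1
        ring)

variable (k : ℕ) (rx : G → R) (rb : R) (α β : Fin 3 → R)

@[simp]
theorem detect_gen (i : Gen G) : detect k rx rb α β (gen (deg k) i) = detectGen rx rb α β i :=
  lift_gen _ _ _ _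

variable [Group G] [Fintype G]

theorem detect_y : detect k rx rb α β (dGen k .y) =
    topMatrix ((α 0 * β 1 - β 0 * α 1) * rb) := by
  rw [dGen_y, map_mul, map_mul, detect_gen, detect_gen, detect_gen]
  simp only [detectGen, oddMatrix_mul, topMatrix_mul]

theorem detect_z (g : G) : detect k rx rb α β (dGen k (.z g)) =
    topMatrix ((α 0 * β 1 - β 0 * α 1) * ∑ h, colour (g⁻¹ * h) • rx h) +
      algebraMap R _ (rb * rx g ^ (2 * k + 1)) := by
  rw [dGen_z, map_add, map_mul, map_mul, map_mul, map_pow, map_sum]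
  simp only [map_smul, detect_gen, detectGen, smul_algebraMap]
  rw [oddMatrix_mul, ← map_sum, topMatrix_mul, map_mul, map_pow]

theorem detect_s : detect k rx rb α β (dGen k (.s : Gen G)) =
    topMatrix (α 0 * β 2 - β 0 * α 2) +
      algebraMap R _ (rb ^ (7 * k + 2) + ∑ h, rx h ^ (3 * k + 1)) := by
  rw [dGen_s, map_add, map_add, map_mul, map_pow, map_sum]
  simp only [map_pow, detect_gen, detectGen]
  rw [oddMatrix_mul, map_add, map_pow, map_sum, add_assoc]
  simp only [map_pow]

theorem detect_t : detect k rx rb α β (dGen k (.t : Gen G)) =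
    topMatrix (α 1 * β 2 - β 1 * α 2) +
      algebraMap R _ (rb ^ (7 * k) * ∑ h, rx h) := by
  rw [dGen_t, map_add, map_mul, map_mul, map_pow, map_sum]
  simp only [detect_gen, detectGen]
  rw [oddMatrix_mul, map_mul, map_pow, map_sum]

end Detect

/-! ### Morphisms are linear on the generators -/

variable {G : Type}

/-- The matrix form of an endomorphism on the generators. -/
structure LinearForm (G : Type) where
  T : G → G → ℚ
  β : ℚ
  n : Fin 3 → ℚ
  S : G → G → ℚ
  σ : ℚ
  τ : ℚ

/-- An endomorphism has the given matrix form. -/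
structure LinearForm.Represents [Fintype G] {k : ℕ} (L : LinearForm G)
    (φ : FreeCGA (deg (G := G) k) →ₐ[ℚ] FreeCGA (deg (G := G) k)) : Prop where
  x : ∀ g, φ (gen _ (.x g)) = ∑ h, L.T g h • gen _ (.x h)
  b : φ (gen _ .b) = L.β • gen _ .b
  u : φ (gen _ .u) = L.n 0 • gen _ .u
  v : φ (gen _ .v) = L.n 1 • gen _ .v
  y : φ (gen _ .y) = L.n 2 • gen _ .y
  z : ∀ g, φ (gen _ (.z g)) = ∑ h, L.S g h • gen _ (.z h)
  s : φ (gen _ .s) = L.σ • gen _ .s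
  t : φ (gen _ .t) = L.τ • gen _ .t

theorem exists_smul_gen {k : ℕ} (hk : 4 ≤ k) {i : Gen G} (hi : ∀ j, deg k j = deg k i → j = i)
    {a : FreeCGA (deg (G := G) k)} (ha : a ∈ wordGr (deg k) (deg k i)) :
    ∃ c : ℚ, a = c • gen (deg k) i := by
  have h := gr_deg_le hk i ha
  have hset : {j : Gen G | deg k j = deg k i} = {i} := by
    ext j
    simpa using ⟨hi j, fun h => h ▸ rfl⟩
  rw [hset, Set.image_singleton, Submodule.mem_span_singleton] at h
  obtain ⟨c, hc⟩ := h
  exact ⟨c, hc.symm⟩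

theorem exists_sum_gen [Fintype G] {k : ℕ} (hk : 4 ≤ k) {n : ℕ} {γ : G → Gen G}
    (hγ : ∀ g, deg k (γ g) = n) (g₀ : G) (h : ∀ j, deg k j = n → ∃ g, j = γ g)
    {a : FreeCGA (deg (G := G) k)} (ha : a ∈ wordGr (deg k) n) :
    ∃ c : G → ℚ, a = ∑ g, c g • gen (deg k) (γ g) := by
  have h' := gr_deg_le hk (γ g₀) (hγ g₀ ▸ ha)
  have hset : gen (deg k) '' {j : Gen G | deg k j = deg k (γ g₀)} ⊆
      Set.range fun g => gen (deg k) (γ g) := by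
    rintro _ ⟨j, hj, rfl⟩
    obtain ⟨g, rfl⟩ := h j (hj.trans (hγ g₀))
    exact ⟨g, rfl⟩
  obtain ⟨c, hc⟩ := (Submodule.mem_span_range_iff_exists_fun ℚ).1 (Submodule.span_mono hset h')
  exact ⟨c, hc.symm⟩

theorem exists_represents [Fintype G] [Nonempty G] {k : ℕ} (hk : 4 ≤ k)
    (φ : FreeCGA (deg (G := G) k) →ₐ[ℚ] FreeCGA (deg (G := G) k))
    (hφ : ∀ n a, a ∈ wordGr (deg k) n → φ a ∈ wordGr (deg k) n) :
    ∃ L : LinearForm G, L.Represents φ := by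
  have hK : 4 * k ≤ k ^ 2 := by nlinarith
  have hg := fun i : Gen G => hφ _ _ (gen_mem (deg k) i)
  obtain ⟨g₀⟩ := ‹Nonempty G›
  have hx := fun g : G => exists_sum_gen hk (n := 14 * k + 4) (γ := .x) (fun _ => rfl) g₀
    (fun j hj => by cases j with
      | x g => exact ⟨g, rfl⟩
      | _ => simp only [deg] at hj; omega) (hg (.x g))
  have hz := fun g : G => exists_sum_gen hk (n := 28 * k ^ 2 + 28 * k + 5) (γ := .z)
    (fun _ => rfl) g₀
    (fun j hj => by cases j with
      | z g => exact ⟨g, rfl⟩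
      | _ => simp only [deg] at hj; omega) (hg (.z g))
  choose T hT using hx
  choose S hS using hz
  obtain ⟨β, hb⟩ := exists_smul_gen hk (i := .b)
    (fun j hj => by cases j <;> first | rfl | (simp only [deg] at hj; omega)) (hg .b)
  obtain ⟨n0, hu⟩ := exists_smul_gen hk (i := .u)
    (fun j hj => by cases j <;> first | rfl | (simp only [deg] at hj; omega)) (hg .u)
  obtain ⟨n1, hv⟩ := exists_smul_gen hk (i := .v)
    (fun j hj => by cases j <;> first | rfl | (simp only [deg] at hj; omega)) (hg .v)
  obtain ⟨n2, hy⟩ := exists_smul_gen hk (i := .y)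
    (fun j hj => by cases j <;> first | rfl | (simp only [deg] at hj; omega)) (hg .y)
  obtain ⟨σ, hs⟩ := exists_smul_gen hk (i := .s)
    (fun j hj => by cases j <;> first | rfl | (simp only [deg] at hj; omega)) (hg .s)
  obtain ⟨τ, ht⟩ := exists_smul_gen hk (i := .t)
    (fun j hj => by cases j <;> first | rfl | (simp only [deg] at hj; omega)) (hg .t)
  exact ⟨⟨T, β, ![n0, n1, n2], S, σ, τ⟩, hT, hb, hu, hv, hy, hS, hs, ht⟩

/-- An endomorphism acts on the detecting maps by a linear substitution of their parameters, which
turns `φ d = d φ` into polynomial identities over `R`. -/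
theorem LinearForm.Represents.detect_comp [Fintype G] {k : ℕ} {L : LinearForm G}
    {φ : FreeCGA (deg (G := G) k) →ₐ[ℚ] FreeCGA (deg (G := G) k)} (h : L.Represents φ)
    {R : Type} [CommRing R] [Algebra ℚ R] (rx : G → R) (rb : R) (α β : Fin 3 → R)
    (a : FreeCGA (deg (G := G) k)) :
    detect k rx rb α β (φ a) = detect k (fun g => ∑ h, L.T g h • rx h) (L.β • rb)
      (fun i => L.n i • α i) (fun i => L.n i • β i) a := by
  rw [← AlgHom.comp_apply]
  congr 1
  apply hom_ext
  intro i
  rw [AlgHom.comp_apply]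
  cases i with
  | x g =>
    rw [h.x, map_sum, detect_gen, detectGen, map_sum]
    simp only [map_smul, detect_gen, detectGen, smul_algebraMap]
  | b => rw [h.b, map_smul, detect_gen, detect_gen]; exact smul_algebraMap _ _
  | u => rw [h.u, map_smul, detect_gen, detect_gen]; exact smul_oddMatrix _ _ _
  | v => rw [h.v, map_smul, detect_gen, detect_gen]; exact smul_oddMatrix _ _ _
  | y => rw [h.y, map_smul, detect_gen, detect_gen]; exact smul_oddMatrix _ _ _
  | z g =>
    rw [h.z, map_sum, detect_gen]
    simp only [map_smul, detect_gen, detectGen, smul_zero, Finset.sum_const_zero]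
  | s => rw [h.s, map_smul, detect_gen, detect_gen]; exact smul_zero _
  | t => rw [h.t, map_smul, detect_gen, detect_gen]; exact smul_zero _

/-! ### The equations satisfied by the matrix form of an endomorphism -/

variable {G : Type} [Fintype G] {k : ℕ}

namespace LinearForm.Represents

variable {L : LinearForm G} {φ : FreeCGA (deg (G := G) k) →ₐ[ℚ] FreeCGA (deg (G := G) k)}

theorem apply_x (h : L.Represents φ) (g : G) (rx : G → ℚ) (rb : ℚ) (α β : Fin 3 → ℚ) :
    detect k rx rb α β (φ (gen _ (.x g))) 0 0 = ∑ w, L.T g w * rx w := by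
  rw [h.detect_comp, detect_gen]
  rw [detectGen, Matrix.algebraMap_matrix_apply, if_pos rfl]
  rfl

theorem apply_b (h : L.Represents φ) (rx : G → ℚ) (rb : ℚ) (α β : Fin 3 → ℚ) :
    detect k rx rb α β (φ (gen _ .b)) 0 0 = L.β * rb := by
  rw [h.detect_comp, detect_gen]
  simp [detectGen, Matrix.algebraMap_eq_diagonal]

theorem apply_u (h : L.Represents φ) (rx : G → ℚ) (rb : ℚ) (α β : Fin 3 → ℚ) :
    detect k rx rb α β (φ (gen _ .u)) 1 0 = L.n 0 * α 0 := by
  rw [h.detect_comp, detect_gen]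
  simp [detectGen, oddMatrix]

theorem apply_v (h : L.Represents φ) (rx : G → ℚ) (rb : ℚ) (α β : Fin 3 → ℚ) :
    detect k rx rb α β (φ (gen _ .v)) 1 0 = L.n 1 * α 1 := by
  rw [h.detect_comp, detect_gen]
  simp [detectGen, oddMatrix]

end LinearForm.Represents

variable [Group G]

/-- Compatibility with the differential. -/
def CommutesWithDer (φ : FreeCGA (deg (G := G) k) →ₐ[ℚ] FreeCGA (deg (G := G) k)) : Prop :=
  ∀ a, φ (der (dGen k) (dGen_mem k) a) = der (dGen k) (dGen_mem k) (φ a)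

namespace LinearForm.Represents

variable {L : LinearForm G} {φ : FreeCGA (deg (G := G) k) →ₐ[ℚ] FreeCGA (deg (G := G) k)}

theorem n_two_eq (h : L.Represents φ) (hd : CommutesWithDer φ) : L.n 2 = L.n 0 * L.n 1 * L.β := by
  -- With `u ↦ θ₁`, `v ↦ θ₂`, `b ↦ 1` and `x g ↦ 0`, `d y` becomes `θ₁ θ₂`. The equations below come
  -- from similar choices, each isolating one term of a differential.
  have e := congrArg (fun a => detect k (0 : G → ℚ) 1 ![1, 0, 0] ![0, 1, 0] a 3 0)
    (hd (gen _ .y))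
  simp only [der_gen, h.detect_comp, h.y, map_smul, Matrix.smul_apply, detect_y] at e
  simpa [topMatrix] using e.symm

theorem S_eq_pure (h : L.Represents φ) (hd : CommutesWithDer φ) (g : G) (rx : G → ℚ) :
    L.β * (∑ w, L.T g w * rx w) ^ (2 * k + 1) = ∑ w, L.S g w * rx w ^ (2 * k + 1) := by
  have e := congrArg (fun a => detect k rx 1 0 0 a 0 0) (hd (gen _ (.z g)))
  simp only [der_gen, h.detect_comp, h.z, map_sum, map_smul, Matrix.sum_apply,
    Matrix.smul_apply, detect_z, topMatrix_add_zero] at e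
  simpa using e

theorem S_eq_colour (h : L.Represents φ) (hd : CommutesWithDer φ) (g : G) (rx : G → ℚ) :
    L.n 0 * L.n 1 * ∑ w, colour (g⁻¹ * w) * ∑ w', L.T w w' * rx w' =
      ∑ w, L.S g w * ∑ w', colour (w⁻¹ * w') * rx w' := by
  have e := congrArg (fun a => detect k rx 0 ![1, 0, 0] ![0, 1, 0] a 3 0) (hd (gen _ (.z g)))
  simp only [der_gen, h.detect_comp, h.z, map_sum, map_smul, Matrix.sum_apply,
    Matrix.smul_apply, detect_z, topMatrix_add_three] at e
  simpa using e

theorem σ_eq_pure (h : L.Represents φ) (hd : CommutesWithDer φ) (rx : G → ℚ) (rb : ℚ) :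
    (L.β * rb) ^ (7 * k + 2) + ∑ g, (∑ w, L.T g w * rx w) ^ (3 * k + 1) =
      L.σ * (rb ^ (7 * k + 2) + ∑ g, rx g ^ (3 * k + 1)) := by
  have e := congrArg (fun a => detect k rx rb 0 0 a 0 0) (hd (gen _ .s))
  simp only [der_gen, h.detect_comp, h.s, map_smul, Matrix.smul_apply, detect_s,
    topMatrix_add_zero] at e
  simpa using e

theorem σ_eq (h : L.Represents φ) (hd : CommutesWithDer φ) : L.σ = L.n 0 * L.n 2 := by
  have e := congrArg (fun a => detect k (0 : G → ℚ) 0 ![1, 0, 0] ![0, 0, 1] a 3 0) (hd (gen _ .s))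
  simp only [der_gen, h.detect_comp, h.s, map_smul, Matrix.smul_apply, detect_s,
    topMatrix_add_three] at e
  simpa using e.symm

theorem τ_eq_pure (h : L.Represents φ) (hd : CommutesWithDer φ) (rx : G → ℚ) :
    L.β ^ (7 * k) * ∑ g, ∑ w, L.T g w * rx w = L.τ * ∑ g, rx g := by
  have e := congrArg (fun a => detect k rx 1 0 0 a 0 0) (hd (gen _ .t))
  simp only [der_gen, h.detect_comp, h.t, map_smul, Matrix.smul_apply, detect_t,
    topMatrix_add_zero] at e
  simpa using e

theorem τ_eq (h : L.Represents φ) (hd : CommutesWithDer φ) : L.τ = L.n 1 * L.n 2 := by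
  have e := congrArg (fun a => detect k (0 : G → ℚ) 0 ![0, 1, 0] ![0, 0, 1] a 3 0) (hd (gen _ .t))
  simp only [der_gen, h.detect_comp, h.t, map_smul, Matrix.smul_apply, detect_t,
    topMatrix_add_three] at e
  simpa using e.symm

theorem S_eq (h : L.Represents φ) (hd : CommutesWithDer φ) (g w : G) :
    L.S g w = L.β * L.T g w ^ (2 * k + 1) := by
  classical
  have e := h.S_eq_pure hd g (Pi.single w 1)
  simpa [Pi.single_apply, ite_pow] using e.symm

/-- Endomorphisms that agree on the closed generators are equal. -/
theorem eq_of_isClosed {L' : LinearForm G}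
    {φ' : FreeCGA (deg (G := G) k) →ₐ[ℚ] FreeCGA (deg (G := G) k)}
    (h : L.Represents φ) (hd : CommutesWithDer φ) (h' : L'.Represents φ')
    (hd' : CommutesWithDer φ')
    (heq : ∀ i : Gen G, i.IsClosed → φ (gen _ i) = φ' (gen _ i)) : φ = φ' := by
  classical
  have hT : ∀ g w, L.T g w = L'.T g w := by
    intro g w
    have e := h.apply_x g (Pi.single w 1) 0 0 0
    rw [heq (.x g) trivial, h'.apply_x] at e
    simpa [Pi.single_apply] using e.symm
  have hb : L.β = L'.β := by
    have e := h.apply_b 0 1 0 0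
    rw [heq .b trivial, h'.apply_b] at e
    simpa using e.symm
  have h0 : L.n 0 = L'.n 0 := by
    have e := h.apply_u 0 0 1 0
    rw [heq .u trivial, h'.apply_u] at e
    simpa using e.symm
  have h1 : L.n 1 = L'.n 1 := by
    have e := h.apply_v 0 0 1 0
    rw [heq .v trivial, h'.apply_v] at e
    simpa using e.symm
  have h2 : L.n 2 = L'.n 2 := by
    rw [h.n_two_eq hd, h'.n_two_eq hd', h0, h1, hb]
  apply hom_ext
  intro i
  cases i with
  | x g | b | u | v => exact heq _ trivial
  | y => rw [h.y, h'.y, h2]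
  | z g => simp only [h.z, h'.z, h.S_eq hd, h'.S_eq hd', hT, hb]
  | s => rw [h.s, h'.s, h.σ_eq hd, h'.σ_eq hd', h0, h2]
  | t => rw [h.t, h'.t, h.τ_eq hd, h'.τ_eq hd', h1, h2]

end LinearForm.Represents

/-! ### Invertible endomorphisms -/

/-- At `r = a / b` the sides are `2 ^ m * a ^ m` and `2 * a ^ m`. This excludes two nonzero entries
in one row of the matrix on the `x g`. -/
theorem add_pow_ne {a b : ℚ} (ha : a ≠ 0) (hb : b ≠ 0) {m : ℕ} (hm : 2 ≤ m) :
    ∃ r : ℚ, (a + b * r) ^ m ≠ a ^ m + b ^ m * r ^ m := by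
  refine ⟨a / b, fun h => ?_⟩
  rw [← mul_pow, mul_div_cancel₀ _ hb, ← two_mul, ← two_mul, mul_pow] at h
  have h2 : (2 : ℚ) ^ m = 2 ^ 1 := by simpa using mul_right_cancel₀ (pow_ne_zero m ha) h
  have := pow_right_injective₀ (by norm_num : (0 : ℚ) < 2) (by norm_num) h2
  omega

/-- The only solution of the scalar equations. -/
theorem scalars_eq_one {k : ℕ} (hk : 1 ≤ k) {β ξ n0 n1 n2 : ℚ} (hβ : β ≠ 0) (hξ : ξ ≠ 0)
    (e1 : n2 = n0 * n1 * β) (e2 : n0 * n2 = β ^ (7 * k + 2))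
    (e3 : n0 * n2 = ξ ^ (3 * k + 1)) (e4 : n1 * n2 = β ^ (7 * k) * ξ)
    (e5 : n0 * n1 = β * ξ ^ (2 * k)) : β = 1 ∧ ξ = 1 ∧ n0 = 1 ∧ n1 = 1 := by
  -- With `k = j + 1` the exponents `14k - 3` and `6k - 1` of `a3` are natural. Dividing the square
  -- of `β ^ (7k+2) = ξ ^ (3k+1)` by `a3` gives `β ^ 7 = ξ ^ 3`; then `(β ^ 7) ^ k * ξ = β ^ (7k+2)`
  -- gives `ξ = β ^ 2`, whence `β ^ 7 = β ^ 6`.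
  obtain ⟨j, rfl⟩ : ∃ j, k = j + 1 := ⟨k - 1, by omega⟩
  have a1 : n2 = β ^ 2 * ξ ^ (2 * (j + 1)) := by rw [e1, e5]; ring
  have a2 : (n0 * n2) * (n1 * n2) = β ^ 5 * ξ ^ (6 * (j + 1)) := by
    calc (n0 * n2) * (n1 * n2) = (n0 * n1) * n2 ^ 2 := by ring
      _ = _ := by rw [e5, a1]; ring
  have a3 : β ^ (14 * j + 11) = ξ ^ (6 * j + 5) := by
    rw [e2, e4] at a2
    apply mul_left_cancel₀ (mul_ne_zero (pow_ne_zero 5 hβ) hξ)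
    calc β ^ 5 * ξ * β ^ (14 * j + 11) = β ^ (7 * (j + 1) + 2) * (β ^ (7 * (j + 1)) * ξ) := by ring
      _ = _ := by rw [a2]; ring
  have a4 : β ^ 7 = ξ ^ 3 := by
    apply mul_left_cancel₀ (pow_ne_zero (14 * j + 11) hβ)
    calc β ^ (14 * j + 11) * β ^ 7 = (β ^ (7 * (j + 1) + 2)) ^ 2 := by ring
      _ = (ξ ^ (3 * (j + 1) + 1)) ^ 2 := by rw [← e2, e3]
      _ = ξ ^ (6 * j + 5) * ξ ^ 3 := by ring
      _ = _ := by rw [a3]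
  have a5 : ξ = β ^ 2 := by
    apply mul_left_cancel₀ (pow_ne_zero (j + 1) (pow_ne_zero 7 hβ))
    calc (β ^ 7) ^ (j + 1) * ξ = ξ ^ (3 * (j + 1) + 1) := by rw [a4]; ring
      _ = β ^ (7 * (j + 1) + 2) := by rw [← e2, e3]
      _ = _ := by ring
  have a6 : β = 1 := by
    apply mul_left_cancel₀ (pow_ne_zero 6 hβ)
    calc β ^ 6 * β = β ^ 7 := by ring
      _ = β ^ 6 * 1 := by rw [a4, a5]; ring
  have a7 : ξ = 1 := by rw [a5, a6, one_pow]
  have a8 : n2 = 1 := by rw [a1, a6, a7]; simp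
  have a9 : n0 = 1 := by rw [a8, a6] at e2; simpa using e2
  have a10 : n1 = 1 := by rw [a8, a6, a7] at e4; simpa using e4
  exact ⟨a6, a7, a9, a10⟩

theorem LinearForm.Represents.eq_translation (hk : 1 ≤ k) {L L' : LinearForm G}
    {φ φ' : FreeCGA (deg (G := G) k) →ₐ[ℚ] FreeCGA (deg (G := G) k)}
    (h : L.Represents φ) (hd : CommutesWithDer φ) (h' : L'.Represents φ')
    (h1 : ∀ a, φ (φ' a) = a) (h2 : ∀ a, φ' (φ a) = a) :
    ∃ a : G, (∀ g, φ (gen _ (.x g)) = gen _ (.x (a * g))) ∧ φ (gen _ .b) = gen _ .b ∧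
      φ (gen _ .u) = gen _ .u ∧ φ (gen _ .v) = gen _ .v := by
  classical
  have hβ : L.β ≠ 0 := by
    intro h0
    have e := congrArg (fun a => detect k (0 : G → ℚ) 1 0 0 a 0 0) (h2 (gen _ .b))
    simp only [h.b, h0, zero_smul, map_zero, detect_gen, detectGen] at e
    simp at e
  have hrow : ∀ g, ∃ w, L.T g w ≠ 0 := by
    intro g
    by_contra! h0
    have e := congrArg (fun a => detect k (1 : G → ℚ) 1 0 0 a 0 0) (h2 (gen _ (.x g)))
    simp only [h.x, h0, zero_smul, Finset.sum_const_zero, map_zero, detect_gen, detectGen] at e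
    simp at e
  choose π hπ using hrow
  -- Evaluate `S_eq_pure` at `1` on `π g`, `r` on `w` and `0` elsewhere: by `S_eq` the right side
  -- has no cross terms.
  have hmono : ∀ g w, w ≠ π g → L.T g w = 0 := by
    intro g w hw
    by_contra hne
    obtain ⟨r, hr⟩ := add_pow_ne (hπ g) hne (m := 2 * k + 1) (by omega)
    apply hr
    have e := h.S_eq_pure hd g (fun i => (if i = π g then 1 else 0) + if i = w then r else 0)
    have hp : ∀ i, ((if i = π g then (1 : ℚ) else 0) + if i = w then r else 0) ^ (2 * k + 1) =
        (if i = π g then 1 else 0) + if i = w then r ^ (2 * k + 1) else 0 := by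
      intro i
      by_cases hi : i = π g
      · subst hi
        simp [Ne.symm hw]
      · simp [hi, ite_pow]
    simp only [hp] at e
    simp only [mul_add, Finset.sum_add_distrib, mul_ite, mul_one, mul_zero, Finset.sum_ite_eq',
      Finset.mem_univ, if_true, h.S_eq hd] at e
    apply mul_left_cancel₀ hβ
    rw [e]
    ring
  have hsum : ∀ g (rx : G → ℚ), ∑ w, L.T g w * rx w = L.T g (π g) * rx (π g) := by
    intro g rx
    refine Finset.sum_eq_single _ (fun w _ hw => ?_) (by simp)
    rw [hmono g w hw, zero_mul]
  -- The coordinate at a missed `w` would kill every `φ (x g)`, yet `φ (φ' (x w)) = x w`.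
  have hsurj : Function.Surjective π := by
    intro w
    by_contra! hw
    have e := congrArg (fun a => detect k (Pi.single w 1 : G → ℚ) 0 0 0 a 0 0) (h1 (gen _ (.x w)))
    have hz : ∀ g, (Pi.single w 1 : G → ℚ) (π g) = 0 := fun g => Pi.single_eq_of_ne (hw g) _
    simp only [h'.x, map_sum, map_smul, Matrix.sum_apply, Matrix.smul_apply, h.apply_x, hsum,
      hz, mul_zero, smul_zero, Finset.sum_const_zero, detect_gen, detectGen] at e
    simp at e
  have hinj : Function.Injective π := Finite.injective_iff_surjective.2 hsurj
  set ξ := L.T 1 (π 1) with hξdef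
  have hξ : ξ ≠ 0 := hπ 1
  have hsingle : ∀ g w : G, (Pi.single (π w) 1 : G → ℚ) (π g) = if g = w then 1 else 0 := by
    intro g w
    rw [Pi.single_apply]
    simp only [hinj.eq_iff]
  -- The sum of the `x h` in `d t` has equal coefficients, so every row gets the same nonzero entry.
  have hτ : ∀ w, L.β ^ (7 * k) * L.T w (π w) = L.τ := by
    intro w
    have e := h.τ_eq_pure hd (Pi.single (π w) 1)
    simpa [hsum, hsingle] using e
  have hT : ∀ w, L.T w (π w) = ξ := fun w =>
    mul_left_cancel₀ (pow_ne_zero (7 * k) hβ) ((hτ w).trans (hτ 1).symm)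
  have hcol : ∀ g w, L.n 0 * L.n 1 * (colour (g⁻¹ * w) * ξ) =
      L.β * ξ ^ (2 * k + 1) * colour ((π g)⁻¹ * π w) := by
    intro g w
    have e := h.S_eq_colour hd g (Pi.single (π w) 1)
    simp only [hsum, hsingle, hT, h.S_eq hd] at e
    simp only [Pi.single_apply, mul_ite, mul_one, mul_zero, Finset.sum_ite_eq', Finset.mem_univ,
      if_true] at e
    rw [Finset.sum_eq_single (π g) (fun i _ hi => by rw [hmono g i hi]; simp) (by simp), hT] at e
    exact e
  -- On the diagonal both colours are that of `1`, which fixes the ratio of the scalars; off it,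
  -- injectivity of `colour` then gives `w = (π 1)⁻¹ * π w`.
  have e5 : L.n 0 * L.n 1 = L.β * ξ ^ (2 * k) := by
    have e := hcol 1 1
    rw [inv_mul_cancel, inv_mul_cancel] at e
    apply mul_right_cancel₀ (mul_ne_zero (colour_ne_zero (1 : G)) hξ)
    rw [e]
    ring
  have hπeq : ∀ w, π w = π 1 * w := by
    intro w
    have e := hcol 1 w
    rw [e5] at e
    have hne : L.β * ξ ^ (2 * k + 1) ≠ 0 := mul_ne_zero hβ (pow_ne_zero _ hξ)
    have : colour ((1 : G)⁻¹ * w) = colour ((π 1)⁻¹ * π w) := by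
      apply mul_left_cancel₀ hne
      rw [← e]
      ring
    have := colour_injective this
    rw [inv_one, one_mul] at this
    exact eq_mul_of_inv_mul_eq this.symm
  have e2 : L.n 0 * L.n 2 = L.β ^ (7 * k + 2) := by
    have e := h.σ_eq_pure hd 0 1
    rw [h.σ_eq hd] at e
    simpa using e.symm
  have e3 : L.n 0 * L.n 2 = ξ ^ (3 * k + 1) := by
    have e := h.σ_eq_pure hd (Pi.single (π 1) 1) 0
    rw [h.σ_eq hd] at e
    simp only [hsum, hsingle, hT] at e
    simpa [ite_pow, Pi.single_apply] using e.symm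
  have e4 : L.n 1 * L.n 2 = L.β ^ (7 * k) * ξ := by rw [← h.τ_eq hd, ← hτ 1]
  obtain ⟨hβ1, hξ1, hn0, hn1⟩ := scalars_eq_one hk hβ hξ (h.n_two_eq hd) e2 e3 e4 e5
  refine ⟨π 1, fun g => ?_, ?_, ?_, ?_⟩
  · rw [h.x, Finset.sum_eq_single (π g) (fun i _ hi => by rw [hmono g i hi, zero_smul]) (by simp),
      hT, hξ1, one_smul, hπeq g]
  · rw [h.b, hβ1, one_smul]
  · rw [h.u, hn0, one_smul]
  · rw [h.v, hn1, one_smul]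

/-! ### The self-equivalences of the rigid algebra -/

variable {G : Type}

theorem gen_injective (k : ℕ) (g h : G) (e : gen (deg k) (.x g) = gen (deg k) (.x h)) : g = h := by
  classical
  have := congrArg (fun a => detect k (Pi.single g 1 : G → ℚ) 0 0 0 a 0 0) e
  simp only [detect_gen, detectGen, Matrix.algebraMap_matrix_apply, if_true] at this
  by_contra hne
  simp [Pi.single_eq_of_ne (Ne.symm hne)] at this

theorem finite_gen [Finite G] : Finite (Gen G) := by
  let f : Gen G → G ⊕ G ⊕ Fin 6
    | .x g => .inl g
    | .z g => .inr (.inl g)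
    | .b => .inr (.inr 0)
    | .u => .inr (.inr 1)
    | .v => .inr (.inr 2)
    | .y => .inr (.inr 3)
    | .s => .inr (.inr 4)
    | .t => .inr (.inr 5)
  refine Finite.of_injective f fun i j h => ?_
  cases i <;> cases j <;> simp [f] at h <;> simp [h]

section

variable [Group G]

/-- Left translation of the generators. -/
def translateGen (a : G) : Gen G → Gen G
  | .x g => .x (a * g)
  | .z g => .z (a * g)
  | i => i

theorem deg_translateGen (k : ℕ) (a : G) (i : Gen G) : deg k (translateGen a i) = deg k i := by
  cases i <;> rfl

end

variable [Group G] [Fintype G] {k : ℕ}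

/-- The homomorphism of algebras underlying an endomorphism of the rigid algebra. -/
def endAlgHom (f : Hom (model G k) (model G k)) :
    FreeCGA (deg (G := G) k) →ₐ[ℚ] FreeCGA (deg (G := G) k) := f.toAlgHom

theorem endAlgHom_injective :
    Function.Injective (endAlgHom : Hom (model G k) (model G k) → _) :=
  fun _ _ h => Hom.ext h

theorem commutesWithDer (f : Hom (model G k) (model G k)) : CommutesWithDer (endAlgHom f) :=
  f.map_d

theorem exists_represents_endAlgHom (hk : 4 ≤ k) (f : Hom (model G k) (model G k)) :
    ∃ L : LinearForm G, L.Represents (endAlgHom f) :=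
  exists_represents hk _ fun _ _ h => f.map_mem h

theorem end_ext (hk : 4 ≤ k) {f g : Hom (model G k) (model G k)}
    (h : ∀ i : Gen G, i.IsClosed → endAlgHom f (gen _ i) = endAlgHom g (gen _ i)) : f = g := by
  obtain ⟨L, hL⟩ := exists_represents_endAlgHom hk f
  obtain ⟨L', hL'⟩ := exists_represents_endAlgHom hk g
  exact endAlgHom_injective
    (hL.eq_of_isClosed (commutesWithDer f) hL' (commutesWithDer g) h)

/-- Closed generators are cocycles one degree above a zero component, so a homotopy cannot move
them, and they determine the endomorphism. -/
theorem eq_of_homotopic (hk : 4 ≤ k) {f g : Hom (model G k) (model G k)} (h : Homotopic f g) :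
    f = g := by
  refine end_ext hk fun i hi => ?_
  have hpos : deg k i - 1 + 1 = deg k i := by
    have := six_mul_le_deg hk i
    omega
  refine h.apply_eq (B := model G k) (gr_pred_deg hk hi) (a := gen (deg k) i) ?_
    (gen_mem_cocycles_of_isClosed k hi)
  rw [hpos]
  exact gen_mem (deg k) i

theorem mk_injective (hk : 4 ≤ k) :
    Function.Injective (HoHom.mk : Hom (model G k) (model G k) → _) := by
  intro f g h
  -- As homotopy implies equality, the identity descends to homotopy classes and is a left inverse
  -- of `HoHom.mk`.
  exact congrArg (Quot.lift _root_.id fun _ _ => eq_of_homotopic hk) h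

/-- The automorphism of the rigid algebra given by left translation. -/
def translate (k : ℕ) (a : G) : Hom (model G k) (model G k) :=
  freeLift (dGen k) (dGen_mem k) (der_dGen k) (B := model G k)
    (fun i => gen (deg k) (translateGen a i))
    (fun i => deg_translateGen k a i ▸ gen_mem (deg k) (translateGen a i)) (by
      intro i
      have hg := fun j : Gen G => toCDGA_gen (B := model G k)
        (fun i => gen (deg k) (translateGen a i))
        (fun i => deg_translateGen k a i ▸ gen_mem (deg k) (translateGen a i)) j
      refine Eq.trans ?_ (der_gen (dGen k) (dGen_mem k) (translateGen a i)).symm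
      cases i with
      | x g | b | u | v => exact map_zero _
      | y =>
        rw [dGen_y, map_mul, map_mul, hg, hg, hg]
        rfl
      | z g =>
        rw [dGen_z, map_add, map_mul, map_mul, map_mul, map_pow, map_sum]
        simp only [map_smul, hg]
        refine Eq.trans ?_ (dGen_z k (a * g)).symm
        congr 2
        -- The substitution `h ↦ a * h` preserves colours, since `(a * g)⁻¹ * (a * h) = g⁻¹ * h`.
        refine Fintype.sum_equiv (Equiv.mulLeft a) _ _ fun h => ?_
        rw [Equiv.coe_mulLeft, mul_inv_rev, mul_assoc, inv_mul_cancel_left]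
        rfl
      | s =>
        rw [dGen_s, map_add, map_add, map_mul, map_pow, map_sum]
        simp only [map_pow, hg]
        refine Eq.trans ?_ (dGen_s k).symm
        congr 1
        exact Fintype.sum_equiv (Equiv.mulLeft a) _ _ fun h => rfl
      | t =>
        rw [dGen_t, map_add, map_mul, map_mul, map_pow, map_sum]
        simp only [hg]
        refine Eq.trans ?_ (dGen_t k).symm
        congr 2
        exact Fintype.sum_equiv (Equiv.mulLeft a) _ _ fun h => rfl)

theorem translate_gen (k : ℕ) (a : G) (i : Gen G) :
    endAlgHom (translate k a) (gen _ i) = gen _ (translateGen a i) :=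
  toCDGA_gen (B := model G k) _
    (fun i => deg_translateGen k a i ▸ gen_mem (deg k) (translateGen a i)) i

theorem end_ext_gen {f g : Hom (model G k) (model G k)}
    (h : ∀ i : Gen G, endAlgHom f (gen _ i) = endAlgHom g (gen _ i)) : f = g :=
  endAlgHom_injective (hom_ext h)

theorem translate_one (k : ℕ) : translate k (1 : G) = Hom.id (model G k) := by
  refine end_ext_gen fun i => ?_
  rw [translate_gen]
  cases i <;> simp only [translateGen, one_mul] <;> rfl

theorem translate_mul (k : ℕ) (a c : G) :
    translate k (a * c) = (translate k a).comp (translate k c) := by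
  refine end_ext_gen fun i => ?_
  refine Eq.trans ?_ (congrArg (endAlgHom (translate k a)) (translate_gen k c i)).symm
  rw [translate_gen, translate_gen]
  cases i <;> simp only [translateGen, mul_assoc]

theorem exists_eq_translate (hk : 4 ≤ k) {f f' : Hom (model G k) (model G k)}
    (h1 : f.comp f' = Hom.id _) (h2 : f'.comp f = Hom.id _) : ∃ a : G, f = translate k a := by
  obtain ⟨L, hL⟩ := exists_represents_endAlgHom hk f
  obtain ⟨L', hL'⟩ := exists_represents_endAlgHom hk f'
  obtain ⟨a, hx, hb, hu, hv⟩ := hL.eq_translation (by omega) (commutesWithDer f) hL'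
    (fun a => congrArg (fun F => endAlgHom F a) h1) (fun a => congrArg (fun F => endAlgHom F a) h2)
  refine ⟨a, end_ext hk fun i hi => ?_⟩
  rw [translate_gen]
  cases i with
  | x g => exact hx g
  | b => exact hb
  | u => exact hu
  | v => exact hv
  | y | z g | s | t => exact hi.elim

variable (G k) in
/-- The homotopy classes of the translations. -/
def translateHom : G →* HoHom (model G k) (model G k) where
  toFun a := HoHom.mk (translate k a)
  map_one' := congrArg HoHom.mk (translate_one k)
  map_mul' a c := congrArg HoHom.mk (translate_mul k a c)

theorem bijective_toHomUnits (hk : 4 ≤ k) :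
    Function.Bijective (translateHom G k).toHomUnits := by
  constructor
  · intro a c h
    have h1 : translate k a = translate k c := mk_injective hk (congrArg Units.val h)
    have h2 := congrArg (fun F => endAlgHom F (gen _ (.x 1))) h1
    simp only [translate_gen, translateGen, mul_one] at h2
    exact gen_injective k a c h2
  · rintro ⟨f, f', h1, h2⟩
    obtain ⟨f, rfl⟩ := Quot.exists_rep f
    obtain ⟨f', rfl⟩ := Quot.exists_rep f'
    obtain ⟨a, rfl⟩ := exists_eq_translate hk (f := f) (f' := f') (mk_injective hk h1)
      (mk_injective hk h2)
    exact ⟨a, Units.ext rfl⟩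

/-- The group of self-equivalences of the rigid algebra. -/
def selfEquivEquiv (hk : 4 ≤ k) : (model G k).SelfEquiv ≃* G :=
  (MulEquiv.ofBijective _ (bijective_toHomUnits hk)).symm

/-! ### Connectivity and minimality -/

theorem isConnectedUpTo (hk : 4 ≤ k) {N : ℕ} (hN : N < 6 * k + 2) :
    (model G k).IsConnectedUpTo N := by
  refine ⟨?_, fun n h1 h2 => gr_eq_bot hk h1 (by omega)⟩
  change Submodule.span ℚ _ = Submodule.span ℚ {1}
  congr 1
  ext a
  constructor
  · rintro ⟨_ | ⟨i, l⟩, hl, rfl⟩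
    · rfl
    · have := six_mul_le_deg hk i
      rw [wordDeg_cons] at hl
      omega
  · rintro rfl
    exact ⟨[], rfl, rfl⟩

/-- The stage at which a generator is added. -/
def stage : Gen G → ℕ
  | .x _ | .b | .u | .v => 0
  | .y => 1
  | .z _ | .s | .t => 2

theorem dGen_mem_adjoin (k : ℕ) (i : Gen G) : dGen k i ∈ Algebra.adjoin ℚ
    {a | ∃ j : Gen G, stage j < stage i ∧ a = gen (deg k) j} := by
  have hg : ∀ j : Gen G, stage j < stage i → gen (deg k) j ∈ Algebra.adjoin ℚ
      {a | ∃ j : Gen G, stage j < stage i ∧ a = gen (deg k) j} :=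
    fun j hj => Algebra.subset_adjoin ⟨j, hj, rfl⟩
  cases i with
  | x g | b | u | v => exact zero_mem _
  | y =>
    exact Subalgebra.mul_mem _ (Subalgebra.mul_mem _ (hg .u Nat.zero_lt_one)
      (hg .v Nat.zero_lt_one)) (hg .b Nat.zero_lt_one)
  | z g =>
    exact Subalgebra.add_mem _ (Subalgebra.mul_mem _ (Subalgebra.mul_mem _ (hg .u Nat.two_pos)
      (hg .v Nat.two_pos)) (Subalgebra.sum_mem _ fun h _ => Subalgebra.smul_mem _
        (hg (.x h) Nat.two_pos) _)) (Subalgebra.mul_mem _ (hg .b Nat.two_pos)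
          (Subalgebra.pow_mem _ (hg (.x g) Nat.two_pos) _))
  | s =>
    exact Subalgebra.add_mem _ (Subalgebra.add_mem _ (Subalgebra.mul_mem _ (hg .u Nat.two_pos)
      (hg .y Nat.one_lt_two)) (Subalgebra.pow_mem _ (hg .b Nat.two_pos) _))
      (Subalgebra.sum_mem _ fun h _ => Subalgebra.pow_mem _ (hg (.x h) Nat.two_pos) _)
  | t =>
    exact Subalgebra.add_mem _ (Subalgebra.mul_mem _ (hg .v Nat.two_pos) (hg .y Nat.one_lt_two))
      (Subalgebra.mul_mem _ (Subalgebra.pow_mem _ (hg .b Nat.two_pos) _)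
        (Subalgebra.sum_mem _ fun h _ => hg (.x h) Nat.two_pos))

theorem dGen_mem_span_word (hk : 4 ≤ k) (i : Gen G) : dGen k i ∈ Submodule.span ℚ
    {a | ∃ l : List (Gen G), 2 ≤ l.length ∧ a = (l.map (gen (deg k))).prod} := by
  have key : ∀ l : List (Gen G), 2 ≤ l.length → word (deg k) l ∈ Submodule.span ℚ
      {a | ∃ l : List (Gen G), 2 ≤ l.length ∧ a = (l.map (gen (deg k))).prod} :=
    fun l hl => Submodule.subset_span ⟨l, hl, rfl⟩
  have hrep : ∀ (j : Gen G) (m : ℕ), word (deg k) (List.replicate m j) = gen (deg k) j ^ m := by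
    intro j m
    simp [word]
  cases i with
  | x g | b | u | v => exact zero_mem _
  | y => simpa [dGen_y, mul_assoc] using key [.u, .v, .b] (by simp)
  | z g =>
    rw [dGen_z, Finset.mul_sum]
    refine add_mem (sum_mem fun h _ => ?_) ?_
    · rw [mul_smul_comm]
      exact Submodule.smul_mem _ _ (by simpa [mul_assoc] using key [.u, .v, .x h] (by simp))
    · simpa [hrep] using key (.b :: List.replicate (2 * k + 1) (.x g)) (by simp)
  | s =>
    rw [dGen_s]
    refine add_mem (add_mem ?_ ?_) (sum_mem fun h _ => ?_)
    · simpa using key [.u, .y] (by simp)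
    · simpa [hrep] using key (List.replicate (7 * k + 2) .b) (by simp)
    · simpa [hrep] using key (List.replicate (3 * k + 1) (.x h)) (by simp; omega)
  | t =>
    rw [dGen_t, Finset.mul_sum]
    refine add_mem ?_ (sum_mem fun h _ => ?_)
    · simpa using key [.v, .y] (by simp)
    · have := key (List.replicate (7 * k) .b ++ [.x h]) (by simp; omega)
      rwa [word_append, hrep, word_cons, word_nil, mul_one] at this

theorem isMinimalSullivan (hk : 4 ≤ k) : (model G k).IsMinimalSullivan := by
  have := finite_gen (G := G)
  refine ⟨{
    I := Gen G
    deg := deg k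
    x := gen (deg k)
    x_mem := gen_mem (deg k)
    two_le_deg := fun i => by have := six_mul_le_deg hk i; omega
    finite_type := fun n => Set.toFinite _
    free := ?_
    stage := stage
    d_stage_zero := ?_
    d_stage := ?_
    minimal := ?_ }⟩
  · have h : FreeCGA.toCDGA (deg k) (model G k) (gen (deg k)) (gen_mem (deg k)) =
        AlgHom.id ℚ (FreeCGA (deg (G := G) k)) := hom_ext fun i => toCDGA_gen _ _ i
    rw [h]
    exact Function.bijective_id
  · intro i hi
    refine (der_gen (dGen k) (dGen_mem k) i).trans ?_
    cases i with
    | x g | b | u | v => rfl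
    | y | z g | s | t => simp [stage] at hi
  · intro i
    exact (der_gen (dGen k) (dGen_mem k) i).symm ▸ dGen_mem_adjoin k i
  · intro i
    exact (der_gen (dGen k) (dGen_mem k) i).symm ▸ dGen_mem_span_word hk i

/-! ### Distinct parameters -/

/-- The generator `b` of the first algebra lies below the lowest positive degree `6l+2` of the
second, so `f` kills it. -/
theorem comp_ne_id_of_lt (hk : 4 ≤ k) {l : ℕ} (hkl : k < l)
    (f : HoHom (model G k) (model G l)) (g : HoHom (model G l) (model G k)) :
    g.comp f ≠ HoHom.mk (Hom.id (model G k)) := by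
  intro h
  obtain ⟨f, rfl⟩ := Quot.exists_rep f
  obtain ⟨g, rfl⟩ := Quot.exists_rep g
  have h1 : g.comp f = Hom.id (model G k) := mk_injective hk h
  have hb : f.toAlgHom (gen (deg k) .b) = 0 := by
    have := f.map_mem (gen_mem (deg k) (.b : Gen G))
    have hbot := gr_eq_bot (G := G) (k := l) (n := 6 * k + 2) (by omega) (by omega) (by omega)
    exact (Submodule.mem_bot ℚ).1 (hbot ▸ this)
  have h2 : g.toAlgHom (f.toAlgHom (gen (deg k) .b)) = gen (deg k) (.b : Gen G) :=
    congrArg (fun F => endAlgHom F (gen (deg k) .b)) h1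
  rw [hb, map_zero] at h2
  have h3 : (0 : FreeCGA (deg (G := G) k)) = gen (deg k) .b := h2
  have h4 := congrArg (fun a => detect k (0 : G → ℚ) 1 0 0 a 0 0) h3
  simp [detectGen] at h4

theorem not_homotopyEquivalent {l : ℕ} (hk : 4 ≤ k) (hl : 4 ≤ l) (hkl : k ≠ l) :
    ¬ (model G k).HomotopyEquivalent (model G l) := by
  rintro ⟨f, g, h1, h2⟩
  rcases hkl.lt_or_gt with h | h
  · exact comp_ne_id_of_lt hk h f g h1
  · exact comp_ne_id_of_lt hl h g f h2

end Rigid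

end CDGA

end

/-! ### The realization theorem -/

theorem mainTheorem3 {G : Type*} [Group G] [Finite G] (N : ℕ) :
    ∃ M : ℕ → CDGA.{0},
      (∀ k, (M k).IsMinimalSullivan ∧ (M k).IsConnectedUpTo N ∧
        Nonempty ((M k).SelfEquiv ≃* G)) ∧
      (∀ k l, k ≠ l → ¬ (M k).HomotopyEquivalent (M l)) := by
  -- The generators are indexed by a group in `Type`; a finite group is small, so it may be replaced
  -- by an isomorphic one there. The offset `N + 4` below ensures both `4 ≤ k` and `N < 6 * k + 2`.
  let e : Shrink.{0} G ≃* G := Shrink.mulEquiv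
  have : Finite (Shrink.{0} G) := Finite.of_equiv G e.symm.toEquiv
  have := Fintype.ofFinite (Shrink.{0} G)
  refine ⟨fun j => CDGA.Rigid.model (Shrink.{0} G) (N + 4 + j), fun j => ⟨?_, ?_, ⟨?_⟩⟩, ?_⟩
  · exact CDGA.Rigid.isMinimalSullivan (by omega)
  · exact CDGA.Rigid.isConnectedUpTo (by omega) (by omega)
  · exact (CDGA.Rigid.selfEquivEquiv (by omega)).trans e
  · intro j l hjl
    exact CDGA.Rigid.not_homotopyEquivalent (by omega) (by omega) (by omega)
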